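/- Let $\Omega=[0,1]^2$, let $\alpha,\rho>0$ and let $I\in H^1(\Omega)$ be the input image. Define $L:H^1(\Omega)\times L^2(\Omega;\mathbb R^2)\times L^2(\Omega;\mathbb R^2)\to\mathbb R$ by $$L(u,v,\mu)=\int_\Omega |v|+\mu\cdot(v-\nabla u)+\frac{\rho}{2}|v-\nabla u|^2+\frac{\alpha}{2}(u-I)^2\,dx .$$ Then $L$ has a saddle point: there are $u^*\in H^1(\Omega)$ and $v^*,\mu^*\in L^2(\Omega;\mathbb R^2)$ with $$L(u^*,v^*,\mu)\le L(u^*,v^*,\mu^*)\le L(u,v,\mu^*)\qquad\text{for all }u\in H^1(\Omega),\ v,\mu\in L^2(\Omega;\mathbb R^2).$$ In particular strong duality holds: $$\min_{u\in H^1(\Omega),\,v\in L^2(\Omega;\mathbb R^2)}\ \sup_{\mu\in L^2(\Omega;\mathbb R^2)}L(u,v,\mu)\;=\;\max_{\mu\in L^2(\Omega;\mathbb R^2)}\ \inf_{u\in H^1(\Omega),\,v\in L^2(\Omega;\mathbb R^2)}L(u,v,\mu)\;=\;L(u^*,v^*,\mu^*),$$ where the inner supremum and infimum are taken in $[-\infty,+\infty]$,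 the outer minimum is attained at $(u^*,v^*)$ and the outer maximum at $\mu^*$ (and at these points the inner supremum and infimum are attained too, by the saddle-point inequalities). -/

import Mathlib

open MeasureTheory Set
open scoped ContDiff

namespace TVSaddle

/-- The Euclidean plane `ℝ²`. -/
abbrev Plane : Type := EuclideanSpace ℝ (Fin 2)

/-- The image domain `Ω = [0,1]²`. -/
def Ω : Set Plane := {x | ∀ i, x i ∈ Icc (0 : ℝ) 1}

/-- Lebesgue measure on `Ω`. -/
noncomputable abbrev volΩ : Measure Plane := volume.restrict Ω

/-- `L²(Ω)`. -/
noncomputable abbrev L2 : Type := Lp ℝ 2 volΩ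

/-- `L²(Ω; ℝ²)`, where `ℝ²` carries the Euclidean norm. -/
noncomputable abbrev L2Vec : Type := Lp Plane 2 volΩ

/-- `g` is the weak gradient of `u` in the interior of `Ω`:
`∫ u ∂ᵢφ = - ∫ gᵢ φ` for all `φ ∈ C_c^∞(int Ω)` and `i = 1, 2`. -/
def IsWeakGradient (u : L2) (g : L2Vec) : Prop :=
  ∀ φ : Plane → ℝ, ContDiff ℝ ∞ φ → HasCompactSupport φ → tsupport φ ⊆ interior Ω →
    ∀ i : Fin 2,
      ∫ x in Ω, u x * fderiv ℝ φ x (EuclideanSpace.single i 1) = -∫ x in Ω, g x i * φ x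

/-- `u ∈ L²(Ω)` belongs to `H¹(Ω)`: it has a weak gradient in `L²(Ω; ℝ²)`. -/
def MemH1 (u : L2) : Prop := ∃ g : L2Vec, IsWeakGradient u g

/-- The Sobolev space `H¹(Ω)`. -/
def H1 : Type := {u : L2 // MemH1 u}

/-- The weak gradient `∇u ∈ L²(Ω; ℝ²)` of `u ∈ H¹(Ω)`; see `IsWeakGradient.unique`. -/
noncomputable def H1.grad (u : H1) : L2Vec := u.2.choose

theorem H1.grad_spec (u : H1) : IsWeakGradient u.1 u.grad := u.2.choose_spec

theorem convex_Ω : Convex ℝ Ω := by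
  intro x hx y hy a b ha hb hab i
  exact (convex_Icc (0 : ℝ) 1) (hx i) (hy i) ha hb hab

theorem isClosed_Ω : IsClosed Ω := by
  have h : Ω = ⋂ i : Fin 2, (fun x : Plane => x i) ⁻¹' Icc (0 : ℝ) 1 := by
    ext x; simp [Ω]
  rw [h]
  exact isClosed_iInter fun i => isClosed_Icc.preimage (by fun_prop)

theorem isBounded_Ω : Bornology.IsBounded Ω := by
  refine (Metric.isBounded_closedBall (x := (0 : Plane)) (r := 2)).subset fun x hx => ?_
  rw [mem_closedBall_zero_iff, EuclideanSpace.norm_eq]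
  refine (Real.sqrt_le_sqrt (y := 2 ^ 2) ?_).trans (by rw [Real.sqrt_sq (by norm_num)])
  have h0 := hx 0
  have h1 := hx 1
  simp only [Fin.sum_univ_two, Real.norm_eq_abs, sq_abs]
  nlinarith [h0.1, h0.2, h1.1, h1.2]

instance isFiniteMeasure_volΩ : IsFiniteMeasure volΩ :=
  ⟨by rw [Measure.restrict_apply_univ]; exact isBounded_Ω.measure_lt_top⟩

/-- The weak gradient is unique. -/
theorem IsWeakGradient.unique {u : L2} {g h : L2Vec}
    (hg : IsWeakGradient u g) (hh : IsWeakGradient u h) : g = h := by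
  have hint (f : L2Vec) (i : Fin 2) : Integrable (fun x => f x i) volΩ :=
    ((Lp.memLp f).integrable (by norm_num)).mono
      ((by fun_prop : Continuous fun y : Plane => y i).comp_aestronglyMeasurable
        (Lp.aestronglyMeasurable f))
      (Filter.Eventually.of_forall fun x => PiLp.norm_apply_le (f x) i)
  have hprod (f : L2Vec) (i : Fin 2) (φ : Plane → ℝ) (h1 : Continuous φ)
      (h2 : HasCompactSupport φ) : Integrable (fun x => f x i * φ x) volΩ := by
    obtain ⟨C, hC⟩ := h2.exists_bound_of_continuous h1
    exact (hint f i).mul_bdd (c := C) h1.aestronglyMeasurable (Filter.Eventually.of_forall hC)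
  have key (i : Fin 2) : ∀ᵐ x ∂volume, x ∈ interior Ω → g x i - h x i = 0 := by
    refine isOpen_interior.ae_eq_zero_of_integral_contDiff_smul_eq_zero ?_ ?_
    · refine IntegrableOn.locallyIntegrableOn ?_
      exact IntegrableOn.mono_set (s := interior Ω) (t := Ω) ((hint g i).sub (hint h i))
        interior_subset
    · intro φ hφ hc hs
      have e := (hg φ hφ hc hs i).symm.trans (hh φ hφ hc hs i)
      have e2 : ∫ x in Ω, (g x i * φ x - h x i * φ x) = 0 := by
        rw [integral_sub (hprod g i φ hφ.continuous hc) (hprod h i φ hφ.continuous hc)]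
        linarith
      rw [← e2, ← setIntegral_eq_integral_of_forall_compl_eq_zero (s := Ω)]
      · exact integral_congr_ae (Filter.Eventually.of_forall fun x => by
          simp only [smul_eq_mul]; ring)
      · intro x hx
        have : φ x = 0 := image_eq_zero_of_notMem_tsupport
          fun hx' => hx (interior_subset (hs hx'))
        simp [this]
  have hfr : ∀ᵐ x ∂(volume : Measure Plane), x ∉ frontier Ω :=
    measure_eq_zero_iff_ae_notMem.1 (convex_Ω.addHaar_frontier volume)
  refine Lp.ext ?_
  refine (ae_restrict_iff' isClosed_Ω.measurableSet).2 ?_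
  filter_upwards [key 0, key 1, hfr] with x h0 h1 h2 hx
  have hxi : x ∈ interior Ω := by
    by_contra hn
    exact h2 ⟨subset_closure hx, hn⟩
  ext i
  fin_cases i
  · exact sub_eq_zero.1 (h0 hxi)
  · exact sub_eq_zero.1 (h1 hxi)

/-- The integrand of the augmented Lagrangian at `x`. -/
noncomputable def integrand (α ρ : ℝ) (I : L2) (p : H1 × L2Vec) (μ : L2Vec) (x : Plane) : ℝ :=
  ‖p.2 x‖ + inner ℝ (μ x) (p.2 x - p.1.grad x)
    + ρ / 2 * ‖p.2 x - p.1.grad x‖ ^ 2 + α / 2 * (p.1.1 x - I x) ^ 2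

/-- The augmented Lagrangian `L(u, v, μ)`, with primal variable `(u, v) ∈ H¹(Ω) × L²(Ω; ℝ²)` and
dual variable `μ ∈ L²(Ω; ℝ²)`. -/
noncomputable def augLagrangian (α ρ : ℝ) (I : L2) (p : H1 × L2Vec) (μ : L2Vec) : ℝ :=
  ∫ x in Ω, integrand α ρ I p μ x

/-- The integral defining `L(u, v, μ)` converges. -/
theorem integrable_integrand (α ρ : ℝ) (I : L2) (p : H1 × L2Vec) (μ : L2Vec) :
    Integrable (integrand α ρ I p μ) volΩ := by
  have hd : MemLp (fun x => p.2 x - p.1.grad x) 2 volΩ := (Lp.memLp p.2).sub (Lp.memLp _)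
  have hi : Integrable (fun x => inner ℝ (μ x) (p.2 x - p.1.grad x)) volΩ := by
    refine (L2.integrable_inner (𝕜 := ℝ) μ (p.2 - p.1.grad)).congr ?_
    filter_upwards [Lp.coeFn_sub p.2 p.1.grad] with x hx
    rw [hx]; rfl
  have hu : MemLp (fun x => p.1.1 x - I x) 2 volΩ := (Lp.memLp p.1.1).sub (Lp.memLp I)
  exact (((((Lp.memLp p.2).integrable (by norm_num)).norm.add hi).add
    (hd.integrable_norm_pow (p := 2) (by norm_num)|>.const_mul _)).add
    (hu.integrable_sq.const_mul _))

end TVSaddle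

namespace TVSaddle

/-! The saddle point is read off from the optimality system of total variation denoising: a function
`u` in H¹ and a field `ν` with ∫ ν·v ≤ ∫ |v| for all `v`, ∫ ν·∇u = ∫ |∇u|, and ∫ ν·∇w = α ∫ (I - u)
w for all `w` in H¹. The pair (u, ∇u) with multiplier -ν is then a saddle point: the terms
containing the constraint vanish at v = ∇u, and expanding the fidelity term around `u` gives the
other inequality (`exists_isSaddlePointOn`).

The difficulty is that `u` must lie in H¹, whereas minimizing the energy directly only yields a
function of bounded variation. Let K be `dualBall`, the set of `f` with ∫ f w ≤ ∫ |∇w|, let `f` be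
the projection of α I on K, and let u = I - f/α. Regularity comes from a symmetry
(`memH1_of_projection`). After even 2-periodic extension, averaging the shifts by ±h in a coordinate
direction does not increase ∫ |∇w|, so it maps K to itself. Testing the variational inequality of
the projection with the averaged `f` bounds a second-difference energy of `u` by that of `I`, which
is O(h²) because `I` is in H¹.

This is carried out in the cosine basis, where the average is the multiplier cos(π kᵢ h) and H¹ is a
weighted ℓ² condition. The modes are complete by Stone–Weierstrass, and weak gradients expand
termwise (`IsWeakGradient.hasSum`) thanks to a Green identity that asks for no boundary condition on
`w`, since the sine modes vanish on the relevant faces.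

Finally, Hahn–Banach turns `f` into `ν` (`exists_field_of_mem_dualBall`). The equality ∫ ν·∇u = ∫
|∇u| holds because `f` maximizes the pairing with `u` over K, and that maximum is at least ∫ |∇u|
(`l1Norm_le_of_dualBall`). -/

/-! ### The square and the L² classes of continuous functions. -/

theorem isCompact_Ω : IsCompact Ω := Metric.isCompact_of_isClosed_isBounded isClosed_Ω isBounded_Ω

theorem measurableSet_Ω : MeasurableSet Ω := isClosed_Ω.measurableSet

theorem ae_mem_interior_Ω : ∀ᵐ x ∂volΩ, x ∈ interior Ω := by
  have hfr : ∀ᵐ x ∂(volume : Measure Plane), x ∉ frontier Ω :=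
    measure_eq_zero_iff_ae_notMem.1 (convex_Ω.addHaar_frontier volume)
  refine (ae_restrict_iff' measurableSet_Ω).2 ?_
  filter_upwards [hfr] with x h2 hx
  by_contra hn
  exact h2 ⟨subset_closure hx, hn⟩

/-- A continuous function is in every `Lᵖ(Ω)`. -/
theorem memLp_of_continuous {E : Type*} [NormedAddCommGroup E] {f : Plane → E}
    (hf : Continuous f) [SecondCountableTopologyEither Plane E] {p : ENNReal} :
    MemLp f p volΩ := by
  obtain ⟨C, hC⟩ := isCompact_Ω.exists_bound_of_continuousOn hf.continuousOn
  refine MemLp.of_bound hf.aestronglyMeasurable C ?_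
  exact (ae_restrict_iff' measurableSet_Ω).2 (Filter.Eventually.of_forall hC)

/-- The class in `L²(Ω)` of a continuous function. -/
noncomputable def scalarLp (f : Plane → ℝ) (hf : Continuous f) : L2 :=
  (memLp_of_continuous hf).toLp f

/-- The class in `L²(Ω; ℝ²)` of a continuous vector field. -/
noncomputable def vecLp (f : Plane → Plane) (hf : Continuous f) : L2Vec :=
  (memLp_of_continuous hf).toLp f

theorem coeFn_scalarLp {f : Plane → ℝ} (hf : Continuous f) : scalarLp f hf =ᵐ[volΩ] f :=
  MemLp.coeFn_toLp _

theorem coeFn_vecLp {f : Plane → Plane} (hf : Continuous f) : vecLp f hf =ᵐ[volΩ] f :=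
  MemLp.coeFn_toLp _

theorem inner_scalarLp {f : Plane → ℝ} (hf : Continuous f) (u : L2) :
    inner ℝ (scalarLp f hf) u = ∫ x in Ω, u x * f x := by
  rw [L2.inner_def]
  refine integral_congr_ae ?_
  filter_upwards [coeFn_scalarLp hf] with x hx
  rw [hx]; rfl

theorem inner_vecLp {f : Plane → Plane} (hf : Continuous f) (g : L2Vec) :
    inner ℝ (vecLp f hf) g = ∫ x in Ω, inner ℝ (f x) (g x) := by
  rw [L2.inner_def]
  refine integral_congr_ae ?_
  filter_upwards [coeFn_vecLp hf] with x hx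
  rw [hx]

theorem inner_vecLp_single {f : Plane → ℝ} (i : Fin 2) (g : L2Vec)
    (hf' : Continuous fun x => EuclideanSpace.single i (f x)) :
    inner ℝ (vecLp (fun x => EuclideanSpace.single i (f x)) hf') g = ∫ x in Ω, g x i * f x := by
  rw [inner_vecLp]
  refine integral_congr_ae (Filter.Eventually.of_forall fun x => ?_)
  simp [EuclideanSpace.inner_single_left, mul_comm]

theorem continuous_single {f : Plane → ℝ} (hf : Continuous f) (i : Fin 2) :
    Continuous fun x => (EuclideanSpace.single i (f x) : Plane) := by
  have : (fun x => (EuclideanSpace.single i (f x) : Plane))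
      = fun x => f x • (EuclideanSpace.single i 1 : Plane) := by
    funext x; ext j; simp
  rw [this]; fun_prop

/-! ### The weak gradient as a closed operator. -/

/-- Test functions are smooth with compact support in the interior of `Ω`. -/
def IsTest (φ : Plane → ℝ) : Prop :=
  ContDiff ℝ ∞ φ ∧ HasCompactSupport φ ∧ tsupport φ ⊆ interior Ω

theorem continuous_partial {f : Plane → ℝ} (hf : ContDiff ℝ ∞ f) (v : Plane) :
    Continuous fun x => fderiv ℝ f x v :=
  (hf.continuous_fderiv (by simp)).clm_apply continuous_const

/-- The graph of the weak gradient. -/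
noncomputable def gradGraph : Submodule ℝ (L2 × L2Vec) :=
  ⨅ (φ : {φ : Plane → ℝ // IsTest φ}) (i : Fin 2),
    LinearMap.ker
      (((innerSL ℝ (scalarLp _ (continuous_partial φ.2.1 (EuclideanSpace.single i 1)))).comp
          (ContinuousLinearMap.fst ℝ L2 L2Vec) +
        (innerSL ℝ (vecLp _ (continuous_single φ.2.1.continuous i))).comp
          (ContinuousLinearMap.snd ℝ L2 L2Vec) : L2 × L2Vec →L[ℝ] ℝ) : L2 × L2Vec →ₗ[ℝ] ℝ)

theorem mem_gradGraph {u : L2} {g : L2Vec} : (u, g) ∈ gradGraph ↔ IsWeakGradient u g := by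
  simp only [gradGraph, Submodule.mem_iInf, LinearMap.mem_ker, Subtype.forall]
  simp only [ContinuousLinearMap.coe_coe, _root_.add_apply,
    ContinuousLinearMap.comp_apply, ContinuousLinearMap.coe_fst', ContinuousLinearMap.coe_snd',
    innerSL_apply_apply, inner_scalarLp]
  constructor
  · intro h φ h1 h2 h3 i
    have := h φ ⟨h1, h2, h3⟩ i
    rw [inner_vecLp_single] at this
    linarith
  · intro h φ hφ i
    rw [inner_vecLp_single]
    have := h φ hφ.1 hφ.2.1 hφ.2.2 i
    linarith

/-- Each test function imposes the vanishing of one bounded functional on L² × L². Closedness is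
what lets termwise gradients of a convergent series pass to the sum. -/
theorem isClosed_gradGraph : IsClosed (gradGraph : Set (L2 × L2Vec)) := by
  simp only [gradGraph, Submodule.coe_iInf]
  exact isClosed_iInter fun φ => isClosed_iInter fun i => ContinuousLinearMap.isClosed_ker _

/-- The classical gradient. -/
noncomputable def classicalGrad (f : Plane → ℝ) (x : Plane) : Plane :=
  WithLp.toLp 2 fun i => fderiv ℝ f x (EuclideanSpace.single i 1)

theorem continuous_classicalGrad {f : Plane → ℝ} (hf : ContDiff ℝ ∞ f) :
    Continuous (classicalGrad f) := by
  unfold classicalGrad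
  exact (PiLp.continuous_toLp 2 _).comp
    (continuous_pi fun i => continuous_partial hf (EuclideanSpace.single i 1))

theorem IsTest.setIntegral_eq {φ : Plane → ℝ} (hφ : IsTest φ) (f : Plane → ℝ) :
    ∫ x in Ω, f x * φ x = ∫ x, f x * φ x := by
  refine setIntegral_eq_integral_of_forall_compl_eq_zero fun x hx => ?_
  rw [image_eq_zero_of_notMem_tsupport fun hx' => hx (interior_subset (hφ.2.2 hx')), mul_zero]

theorem IsTest.setIntegral_fderiv_eq {φ : Plane → ℝ} (hφ : IsTest φ) (f : Plane → ℝ) (v : Plane) :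
    ∫ x in Ω, f x * fderiv ℝ φ x v = ∫ x, f x * fderiv ℝ φ x v := by
  refine setIntegral_eq_integral_of_forall_compl_eq_zero fun x hx => ?_
  have : fderiv ℝ φ x = 0 := image_eq_zero_of_notMem_tsupport
    fun hx' => hx (interior_subset (hφ.2.2 (tsupport_fderiv_subset ℝ hx')))
  simp [this]

theorem integral_mul_fderiv_of_hasCompactSupport {f φ : Plane → ℝ} (hf : ContDiff ℝ ∞ f)
    (hφ : ContDiff ℝ ∞ φ) (hc : HasCompactSupport φ) (v : Plane) :
    ∫ x, f x * fderiv ℝ φ x v = -∫ x, fderiv ℝ f x v * φ x := by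
  have hf' := continuous_partial hf v
  have hφ' := continuous_partial hφ v
  refine integral_mul_fderiv_eq_neg_fderiv_mul_of_integrable ?_ ?_ ?_
    (fun x _ => hf.differentiable (by simp) x) (fun x _ => hφ.differentiable (by simp) x)
  · exact (hf'.mul hφ.continuous).integrable_of_hasCompactSupport hc.mul_left
  · exact (hf.continuous.mul hφ').integrable_of_hasCompactSupport (hc.fderiv_apply ℝ v).mul_left
  · exact (hf.continuous.mul hφ.continuous).integrable_of_hasCompactSupport hc.mul_left

/-- The classical gradient of a smooth function is its weak gradient. -/
theorem isWeakGradient_classicalGrad {f : Plane → ℝ} (hf : ContDiff ℝ ∞ f) :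
    IsWeakGradient (scalarLp f hf.continuous)
      (vecLp (classicalGrad f) (continuous_classicalGrad hf)) := by
  intro φ h1 h2 h3 i
  have hT : IsTest φ := ⟨h1, h2, h3⟩
  have e1 : ∫ x in Ω, scalarLp f hf.continuous x * fderiv ℝ φ x (EuclideanSpace.single i 1)
      = ∫ x in Ω, f x * fderiv ℝ φ x (EuclideanSpace.single i 1) := by
    refine integral_congr_ae ?_
    filter_upwards [coeFn_scalarLp hf.continuous] with x hx
    rw [hx]
  have e2 : ∫ x in Ω, vecLp (classicalGrad f) (continuous_classicalGrad hf) x i * φ x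
      = ∫ x in Ω, fderiv ℝ f x (EuclideanSpace.single i 1) * φ x := by
    refine integral_congr_ae ?_
    filter_upwards [coeFn_vecLp (continuous_classicalGrad hf)] with x hx
    rw [hx]; rfl
  rw [e1, e2, hT.setIntegral_fderiv_eq, hT.setIntegral_eq,
    integral_mul_fderiv_of_hasCompactSupport hf h1 h2]

/-! ### Tensor products and smooth cutoffs of the square. -/

/-- The tensor product of functions of one coordinate. -/
noncomputable def tensor (p : Fin 2 → ℝ → ℝ) (x : Plane) : ℝ := ∏ j, p j (x j)

theorem contDiff_tensor {p : Fin 2 → ℝ → ℝ} (hp : ∀ j, ContDiff ℝ ∞ (p j)) :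
    ContDiff ℝ ∞ (tensor p) := by
  unfold tensor
  refine contDiff_prod fun j _ => (hp j).comp ?_
  fun_prop

theorem fderiv_tensor {p : Fin 2 → ℝ → ℝ} (hp : ∀ j, Differentiable ℝ (p j)) (i : Fin 2)
    (x : Plane) : fderiv ℝ (tensor p) x (EuclideanSpace.single i 1)
      = deriv (p i) (x i) * ∏ j ∈ Finset.univ.erase i, p j (x j) := by
  have h (j : Fin 2) : HasFDerivAt (fun y : Plane => p j (y j))
      (deriv (p j) (x j) • (EuclideanSpace.proj j : Plane →L[ℝ] ℝ)) x :=
    ((hp j (x j)).hasDerivAt).comp_hasFDerivAt x (EuclideanSpace.proj j : Plane →L[ℝ] ℝ).hasFDerivAt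
  have := HasFDerivAt.finsetProd (u := Finset.univ) fun j _ => h j
  unfold tensor
  rw [HasFDerivAt.fderiv this]
  fin_cases i <;> simp [mul_comm]

theorem differentiable_smoothTransition : Differentiable ℝ Real.smoothTransition :=
  (Real.smoothTransition.contDiff (n := ⊤)).differentiable (by simp)

theorem deriv_smoothTransition_of_one_lt {s : ℝ} (hs : 1 < s) :
    deriv Real.smoothTransition s = 0 := by
  have : Real.smoothTransition =ᶠ[nhds s] fun _ => 1 := by
    filter_upwards [lt_mem_nhds hs] with t ht
    exact Real.smoothTransition.one_of_one_le ht.le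
  rw [this.deriv_eq, deriv_const]

theorem deriv_smoothTransition_of_neg {s : ℝ} (hs : s < 0) :
    deriv Real.smoothTransition s = 0 := by
  have : Real.smoothTransition =ᶠ[nhds s] fun _ => 0 := by
    filter_upwards [gt_mem_nhds hs] with t ht
    exact Real.smoothTransition.zero_of_nonpos ht.le
  rw [this.deriv_eq, deriv_const]

/-- The derivative vanishes off [0, 1]. The factor s + 1 is n t at s = n t - 1, so the bound
controls the slope of the cutoff times the distance to the endpoint, uniformly in n. -/
theorem exists_bound_deriv_smoothTransition :
    ∃ M : ℝ, 0 ≤ M ∧ ∀ s : ℝ, |(s + 1) * deriv Real.smoothTransition s| ≤ M := by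
  have hc : Continuous fun s : ℝ => (s + 1) * deriv Real.smoothTransition s :=
    (by fun_prop : Continuous fun s : ℝ => s + 1).mul
      ((Real.smoothTransition.contDiff (n := 1)).continuous_deriv (by simp))
  obtain ⟨C, hC⟩ := (isCompact_Icc (a := (0 : ℝ)) (b := 1)).exists_bound_of_continuousOn
    hc.continuousOn
  refine ⟨max C 0, le_max_right _ _, fun s => ?_⟩
  rcases lt_or_ge s 0 with h | h
  · simp [deriv_smoothTransition_of_neg h]
  rcases lt_or_ge 1 s with h1 | h1
  · simp [deriv_smoothTransition_of_one_lt h1]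
  · exact (hC s ⟨h, h1⟩).trans (le_max_left _ _)

/-- A smooth cutoff function of `(0, 1)`, equal to `1` on `[2 / n, 1 - 2 / n]`. -/
noncomputable def cutoff (n : ℕ) (t : ℝ) : ℝ :=
  Real.smoothTransition (n * t - 1) * Real.smoothTransition (n * (1 - t) - 1)

theorem contDiff_cutoff (n : ℕ) : ContDiff ℝ ∞ (cutoff n) := by
  unfold cutoff
  exact (Real.smoothTransition.contDiff.comp (by fun_prop)).mul
    (Real.smoothTransition.contDiff.comp (by fun_prop))

theorem cutoff_nonneg (n : ℕ) (t : ℝ) : 0 ≤ cutoff n t :=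
  mul_nonneg (Real.smoothTransition.nonneg _) (Real.smoothTransition.nonneg _)

theorem cutoff_le_one (n : ℕ) (t : ℝ) : cutoff n t ≤ 1 :=
  mul_le_one₀ (Real.smoothTransition.le_one _) (Real.smoothTransition.nonneg _)
    (Real.smoothTransition.le_one _)

theorem abs_cutoff_le_one (n : ℕ) (t : ℝ) : |cutoff n t| ≤ 1 := by
  rw [abs_of_nonneg (cutoff_nonneg n t)]; exact cutoff_le_one n t

theorem mem_of_cutoff_ne_zero {n : ℕ} {t : ℝ} (h : cutoff n t ≠ 0) :
    1 ≤ n * t ∧ 1 ≤ n * (1 - t) := by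
  constructor
  · by_contra! hn
    exact h (by rw [cutoff, Real.smoothTransition.zero_of_nonpos (by linarith), zero_mul])
  · by_contra! hn
    exact h (by
      rw [cutoff, Real.smoothTransition.zero_of_nonpos (x := n * (1 - t) - 1) (by linarith),
        mul_zero])

/-- The threshold 2 puts n t - 1 strictly beyond 1, where the transition function is locally
constant. -/
theorem eventually_two_lt_mul {t : ℝ} (ht : 0 < t) : ∀ᶠ n : ℕ in Filter.atTop, 2 < n * t :=
  (tendsto_natCast_atTop_atTop.atTop_mul_const ht).eventually_gt_atTop 2

theorem eventually_cutoff_eq_one {t : ℝ} (ht : t ∈ Ioo (0 : ℝ) 1) :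
    ∀ᶠ n : ℕ in Filter.atTop, cutoff n t = 1 := by
  filter_upwards [eventually_two_lt_mul ht.1, eventually_two_lt_mul (sub_pos.2 ht.2)] with n h1 h2
  rw [cutoff, Real.smoothTransition.one_of_one_le (by linarith),
    Real.smoothTransition.one_of_one_le (by linarith), mul_one]

theorem deriv_cutoff (n : ℕ) (t : ℝ) : deriv (cutoff n) t =
    n * deriv Real.smoothTransition (n * t - 1) * Real.smoothTransition (n * (1 - t) - 1)
      - Real.smoothTransition (n * t - 1) *
        (n * deriv Real.smoothTransition (n * (1 - t) - 1)) := by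
  have h1 : HasDerivAt (fun t : ℝ => n * t - 1) (n : ℝ) t := by
    simpa using ((hasDerivAt_id t).const_mul (n : ℝ)).sub_const 1
  have h2 : HasDerivAt (fun t : ℝ => n * (1 - t) - 1) (-n : ℝ) t := by
    simpa using (((hasDerivAt_id t).const_sub 1).const_mul (n : ℝ)).sub_const 1
  have h3 := (differentiable_smoothTransition (n * t - 1)).hasDerivAt.comp t h1
  have h4 := (differentiable_smoothTransition (n * (1 - t) - 1)).hasDerivAt.comp t h2
  have := (h3.mul h4).deriv
  refine Eq.trans ?_ (this.trans ?_)
  · rfl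
  · simp only [Function.comp]; ring

theorem eventually_deriv_cutoff_eq_zero {t : ℝ} (ht : t ∈ Ioo (0 : ℝ) 1) :
    ∀ᶠ n : ℕ in Filter.atTop, deriv (cutoff n) t = 0 := by
  filter_upwards [eventually_two_lt_mul ht.1, eventually_two_lt_mul (sub_pos.2 ht.2)] with n h1 h2
  rw [deriv_cutoff, deriv_smoothTransition_of_one_lt (by linarith),
    deriv_smoothTransition_of_one_lt (by linarith)]
  ring

/-- The derivative of the cutoff is controlled by the inverse distance to `{0, 1}`. -/
theorem exists_bound_deriv_cutoff : ∃ M : ℝ, 0 ≤ M ∧ ∀ (n : ℕ) (t y L : ℝ), 0 ≤ t → t ≤ 1 →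
    0 ≤ L → |y| ≤ L * t → |y| ≤ L * (1 - t) → |deriv (cutoff n) t * y| ≤ L * M := by
  obtain ⟨M, hM0, hM⟩ := exists_bound_deriv_smoothTransition
  have key (n : ℕ) (s y L c : ℝ) (hs : 0 ≤ s) (hL : 0 ≤ L) (hy : |y| ≤ L * s) (hc : |c| ≤ 1) :
      |n * deriv Real.smoothTransition (n * s - 1) * c * y| ≤ L * M := by
    have h := hM (n * s - 1)
    rw [sub_add_cancel, abs_mul, abs_of_nonneg (by positivity)] at h
    calc |n * deriv Real.smoothTransition (n * s - 1) * c * y|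
        = n * |deriv Real.smoothTransition (n * s - 1)| * |c| * |y| := by
          simp [abs_mul]
      _ ≤ n * |deriv Real.smoothTransition (n * s - 1)| * 1 * (L * s) := by gcongr
      _ = L * (n * s * |deriv Real.smoothTransition (n * s - 1)|) := by ring
      _ ≤ L * M := by gcongr
  have hS (s : ℝ) : |Real.smoothTransition s| ≤ 1 := by
    rw [abs_of_nonneg (Real.smoothTransition.nonneg _)]; exact Real.smoothTransition.le_one _
  -- One `M` for each endpoint of [0, 1], by the product rule.
  refine ⟨M + M, by linarith, fun n t y L ht0 ht1 hL h1 h2 => ?_⟩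
  have a1 := key n t y L _ ht0 hL h1 (hS (n * (1 - t) - 1))
  have a2 := key n (1 - t) y L _ (by linarith) hL h2 (hS (n * t - 1))
  rw [deriv_cutoff, sub_mul, mul_add]
  refine (abs_sub _ _).trans (add_le_add a1 ?_)
  refine le_of_eq_of_le ?_ a2
  congr 1
  ring

theorem mem_interior_Ω {x : Plane} : x ∈ interior Ω ↔ ∀ i, x i ∈ Ioo (0 : ℝ) 1 := by
  have h : Ω = (EuclideanSpace.equiv (Fin 2) ℝ).toHomeomorph ⁻¹'
      (Set.univ.pi fun _ => Icc (0 : ℝ) 1) := by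
    ext x
    rw [mem_preimage, Set.mem_univ_pi]
    rfl
  rw [h, ← Homeomorph.preimage_interior, interior_pi_set Set.finite_univ]
  simp

/-- A smooth cutoff function of the interior of `Ω`. -/
noncomputable def cutoffΩ (n : ℕ) : Plane → ℝ := tensor fun _ => cutoff n

theorem contDiff_cutoffΩ (n : ℕ) : ContDiff ℝ ∞ (cutoffΩ n) :=
  contDiff_tensor fun _ => contDiff_cutoff n

theorem abs_cutoffΩ_le_one (n : ℕ) (x : Plane) : |cutoffΩ n x| ≤ 1 := by
  rw [cutoffΩ, tensor, Finset.abs_prod]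
  exact Finset.prod_le_one (fun _ _ => abs_nonneg _) fun _ _ => abs_cutoff_le_one _ _

theorem eventually_cutoffΩ_eq_one {x : Plane} (hx : x ∈ interior Ω) :
    ∀ᶠ n : ℕ in Filter.atTop, cutoffΩ n x = 1 := by
  rw [mem_interior_Ω] at hx
  filter_upwards [eventually_cutoff_eq_one (hx 0), eventually_cutoff_eq_one (hx 1)] with n h0 h1
  simp [cutoffΩ, tensor, h0, h1]

theorem tsupport_cutoffΩ_subset (n : ℕ) : tsupport (cutoffΩ n) ⊆ interior Ω := by
  have hcl : IsClosed {x : Plane | ∀ j, 1 ≤ n * x j ∧ 1 ≤ n * (1 - x j)} := by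
    simp only [Set.ofPred_forall, Set.ofPred_and]
    exact isClosed_iInter fun j => (isClosed_le (by fun_prop) (by fun_prop)).inter
      (isClosed_le (by fun_prop) (by fun_prop))
  refine (closure_minimal (fun x hx j => ?_) hcl).trans fun x hx => ?_
  · rw [Function.mem_support, cutoffΩ, tensor] at hx
    exact mem_of_cutoff_ne_zero (Finset.prod_ne_zero_iff.1 hx j (Finset.mem_univ j))
  · refine mem_interior_Ω.2 fun j => ⟨?_, ?_⟩
    · exact pos_of_mul_pos_right (a := (n : ℝ)) (by linarith [(hx j).1]) (by positivity)
    · exact sub_pos.1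
        (pos_of_mul_pos_right (a := (n : ℝ)) (by linarith [(hx j).2]) (by positivity))

/-- Multiplication by the cutoff turns smooth functions into test functions. -/
theorem isTest_cutoffΩ_mul (n : ℕ) {ψ : Plane → ℝ} (hψ : ContDiff ℝ ∞ ψ) :
    IsTest fun x => cutoffΩ n x * ψ x := by
  refine ⟨(contDiff_cutoffΩ n).mul hψ, ?_, (tsupport_mul_subset_left).trans
    (tsupport_cutoffΩ_subset n)⟩
  refine HasCompactSupport.mul_right ?_
  exact isCompact_Ω.of_isClosed_subset (isClosed_tsupport _)
    ((tsupport_cutoffΩ_subset n).trans interior_subset)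

theorem fderiv_cutoffΩ (n : ℕ) (x : Plane) (i : Fin 2) :
    fderiv ℝ (cutoffΩ n) x (EuclideanSpace.single i 1)
      = deriv (cutoff n) (x i) * ∏ j ∈ Finset.univ.erase i, cutoff n (x j) :=
  fderiv_tensor (fun _ => (contDiff_cutoff n).differentiable (by simp)) i x

/-! ### Integration by parts up to the boundary. -/

theorem integrable_coord (g : L2Vec) (i : Fin 2) : Integrable (fun x => g x i) volΩ :=
  ((Lp.memLp g).integrable (by norm_num)).mono
    ((by fun_prop : Continuous fun y : Plane => y i).comp_aestronglyMeasurable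
      (Lp.aestronglyMeasurable g))
    (Filter.Eventually.of_forall fun x => PiLp.norm_apply_le (g x) i)

theorem tendsto_setIntegral_cutoffΩ_mul (g : L2Vec) (i : Fin 2) {ψ : Plane → ℝ}
    (hψ : Continuous ψ) :
    Filter.Tendsto (fun n : ℕ => ∫ x in Ω, g x i * (cutoffΩ n x * ψ x)) Filter.atTop
      (nhds (∫ x in Ω, g x i * ψ x)) := by
  obtain ⟨C, hC⟩ := isCompact_Ω.exists_bound_of_continuousOn hψ.continuousOn
  refine tendsto_integral_of_dominated_convergence (fun x => |g x i| * C) (fun n => ?_)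
    ((integrable_coord g i).abs.mul_const _) (fun n => ?_) ?_
  · exact (integrable_coord g i).aestronglyMeasurable.mul
      ((contDiff_cutoffΩ n).continuous.mul hψ).aestronglyMeasurable
  · refine (ae_restrict_iff' measurableSet_Ω).2 (Filter.Eventually.of_forall fun x hx => ?_)
    rw [Real.norm_eq_abs, abs_mul, abs_mul]
    gcongr
    exact (mul_le_of_le_one_left (abs_nonneg _) (abs_cutoffΩ_le_one n x)).trans (hC x hx)
  · filter_upwards [ae_mem_interior_Ω] with x hx
    refine Filter.EventuallyEq.tendsto ?_
    filter_upwards [eventually_cutoffΩ_eq_one hx] with n e1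
    rw [e1, one_mul]

/-- Integration by parts against a smooth function vanishing on the faces of `Ω` orthogonal to the
direction of the derivative. -/
theorem IsWeakGradient.integral_fderiv_eq {w : L2} {g : L2Vec} (h : IsWeakGradient w g)
    {ψ : Plane → ℝ} (hψ : ContDiff ℝ ∞ ψ) (i : Fin 2) {L : ℝ} (hL : 0 ≤ L)
    (h0 : ∀ x ∈ Ω, |ψ x| ≤ L * x i) (h1 : ∀ x ∈ Ω, |ψ x| ≤ L * (1 - x i)) :
    ∫ x in Ω, w x * fderiv ℝ ψ x (EuclideanSpace.single i 1) = -∫ x in Ω, g x i * ψ x := by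
  obtain ⟨M, hM0, hM⟩ := exists_bound_deriv_cutoff
  have hψ' := continuous_partial hψ (EuclideanSpace.single i 1)
  obtain ⟨C, hC⟩ := isCompact_Ω.exists_bound_of_continuousOn hψ'.continuousOn
  have hw : Integrable (fun x => w x) volΩ := (Lp.memLp w).integrable (by norm_num)
  have hd (n : ℕ) (x : Plane) :
      fderiv ℝ (fun y => cutoffΩ n y * ψ y) x (EuclideanSpace.single i 1)
        = cutoffΩ n x * fderiv ℝ ψ x (EuclideanSpace.single i 1)
          + (∏ j ∈ Finset.univ.erase i, cutoff n (x j)) * (deriv (cutoff n) (x i) * ψ x) := by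
    have := fderiv_cutoffΩ n x i
    rw [fderiv_fun_mul ((contDiff_cutoffΩ n).differentiable (by simp) x)
      (hψ.differentiable (by simp) x)]
    simp only [_root_.add_apply, _root_.smul_apply, smul_eq_mul, this]
    ring
  have hE (n : ℕ) := h _ (isTest_cutoffΩ_mul n hψ).1 (isTest_cutoffΩ_mul n hψ).2.1
    (isTest_cutoffΩ_mul n hψ).2.2 i
  have lim1 : Filter.Tendsto (fun n : ℕ => ∫ x in Ω,
      w x * fderiv ℝ (fun y => cutoffΩ n y * ψ y) x (EuclideanSpace.single i 1)) Filter.atTop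
      (nhds (∫ x in Ω, w x * fderiv ℝ ψ x (EuclideanSpace.single i 1))) := by
    -- `C` bounds the derivative of ψ. The term where the derivative hits the cutoff grows like n
    -- near the faces, but the linear decay of ψ there keeps it below L M, and it tends to 0
    -- pointwise inside.
    refine tendsto_integral_of_dominated_convergence (fun x => |w x| * (C + L * M)) (fun n => ?_)
      (hw.abs.mul_const _) (fun n => ?_) ?_
    · exact hw.aestronglyMeasurable.mul
        (continuous_partial (isTest_cutoffΩ_mul n hψ).1 _).aestronglyMeasurable
    · refine (ae_restrict_iff' measurableSet_Ω).2 (Filter.Eventually.of_forall fun x hx => ?_)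
      rw [Real.norm_eq_abs, abs_mul, hd]
      gcongr
      refine (abs_add_le _ _).trans (add_le_add ?_ ?_)
      · rw [abs_mul]
        exact (mul_le_of_le_one_left (abs_nonneg _) (abs_cutoffΩ_le_one n x)).trans (hC x hx)
      · rw [abs_mul]
        refine (mul_le_of_le_one_left (abs_nonneg _) ?_).trans
          (hM n (x i) (ψ x) L (hx i).1 (hx i).2 hL (h0 x hx) (h1 x hx))
        rw [Finset.abs_prod]
        exact Finset.prod_le_one (fun _ _ => abs_nonneg _) fun _ _ => abs_cutoff_le_one _ _
    · filter_upwards [ae_mem_interior_Ω] with x hx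
      refine Filter.EventuallyEq.tendsto ?_
      filter_upwards [eventually_cutoffΩ_eq_one hx,
        eventually_deriv_cutoff_eq_zero (mem_interior_Ω.1 hx i)] with n e1 e2
      rw [hd, e1, e2]; ring
  have lim2 := tendsto_setIntegral_cutoffΩ_mul g i hψ.continuous
  simp only [hE] at lim1
  exact tendsto_nhds_unique lim1 lim2.neg

/-! ### Neumann eigenfunctions and the Green identity. -/

/-- The product of the cosine factors of a mode in the coordinates other than `i`. -/
noncomputable def cosCofactor (k : Fin 2 → ℕ) (i : Fin 2) (x : Plane) : ℝ :=
  ∏ j ∈ Finset.univ.erase i, Real.cos (Real.pi * k j * x j)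

/-- The Neumann eigenfunctions `∏ⱼ cos (π kⱼ xⱼ)` of the square. -/
noncomputable def cosMode (k : Fin 2 → ℕ) : Plane → ℝ :=
  tensor fun j t => Real.cos (Real.pi * k j * t)

/-- The mode `cosMode k` with its `i`-th cosine replaced by a sine. -/
noncomputable def sinMode (k : Fin 2 → ℕ) (i : Fin 2) : Plane → ℝ :=
  tensor (Function.update (fun j t => Real.cos (Real.pi * k j * t)) i
    fun t => Real.sin (Real.pi * k i * t))

theorem cosMode_eq (k : Fin 2 → ℕ) (i : Fin 2) (x : Plane) :
    cosMode k x = Real.cos (Real.pi * k i * x i) * cosCofactor k i x := by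
  rw [cosMode, tensor, cosCofactor, ← Finset.mul_prod_erase _ _ (Finset.mem_univ i)]

theorem prod_erase_update (p : Fin 2 → ℝ → ℝ) (i : Fin 2) (q : ℝ → ℝ) (x : Plane) :
    ∏ j ∈ Finset.univ.erase i, Function.update p i q j (x j)
      = ∏ j ∈ Finset.univ.erase i, p j (x j) :=
  Finset.prod_congr rfl fun j hj => by rw [Function.update_of_ne (Finset.ne_of_mem_erase hj)]

theorem sinMode_eq (k : Fin 2 → ℕ) (i : Fin 2) (x : Plane) :
    sinMode k i x = Real.sin (Real.pi * k i * x i) * cosCofactor k i x := by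
  rw [sinMode, tensor, ← Finset.mul_prod_erase _ _ (Finset.mem_univ i), prod_erase_update,
    Function.update_self]
  rfl

theorem contDiff_cosMode (k : Fin 2 → ℕ) : ContDiff ℝ ∞ (cosMode k) :=
  contDiff_tensor fun j => Real.contDiff_cos.comp (by fun_prop)

theorem contDiff_sinMode (k : Fin 2 → ℕ) (i : Fin 2) : ContDiff ℝ ∞ (sinMode k i) := by
  refine contDiff_tensor fun j => ?_
  rcases eq_or_ne j i with rfl | h
  · rw [Function.update_self]; exact Real.contDiff_sin.comp (by fun_prop)
  · rw [Function.update_of_ne h]; exact Real.contDiff_cos.comp (by fun_prop)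

theorem abs_cosCofactor_le_one (k : Fin 2 → ℕ) (i : Fin 2) (x : Plane) :
    |cosCofactor k i x| ≤ 1 := by
  rw [cosCofactor, Finset.abs_prod]
  exact Finset.prod_le_one (fun _ _ => abs_nonneg _) fun _ _ => Real.abs_cos_le_one _

theorem fderiv_cosMode (k : Fin 2 → ℕ) (i : Fin 2) (x : Plane) :
    fderiv ℝ (cosMode k) x (EuclideanSpace.single i 1) = -(Real.pi * k i) * sinMode k i x := by
  have hd : deriv (fun t => Real.cos (Real.pi * k i * t)) (x i)
      = -(Real.pi * k i) * Real.sin (Real.pi * k i * x i) := by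
    have := (((hasDerivAt_id (x i)).const_mul (Real.pi * k i)).cos).deriv
    simp only [id, mul_one] at this
    rw [this]; ring
  rw [cosMode, fderiv_tensor, hd, sinMode_eq, cosCofactor, mul_assoc]
  exact fun j => (Real.contDiff_cos.comp (by fun_prop : ContDiff ℝ 1 _)).differentiable (by simp)

theorem fderiv_sinMode (k : Fin 2 → ℕ) (i : Fin 2) (x : Plane) :
    fderiv ℝ (sinMode k i) x (EuclideanSpace.single i 1) = Real.pi * k i * cosMode k x := by
  have hd : deriv (fun t => Real.sin (Real.pi * k i * t)) (x i)
      = Real.pi * k i * Real.cos (Real.pi * k i * x i) := by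
    have := (((hasDerivAt_id (x i)).const_mul (Real.pi * k i)).sin).deriv
    simp only [id, mul_one] at this
    rw [this]; ring
  rw [sinMode, fderiv_tensor, prod_erase_update, Function.update_self, hd, cosMode_eq k i,
    cosCofactor, mul_assoc]
  intro j
  rcases eq_or_ne j i with rfl | h
  · rw [Function.update_self]
    exact (Real.contDiff_sin.comp (by fun_prop : ContDiff ℝ 1 _)).differentiable (by simp)
  · rw [Function.update_of_ne h]
    exact (Real.contDiff_cos.comp (by fun_prop : ContDiff ℝ 1 _)).differentiable (by simp)

/-- The class of `cosMode k` in `L²(Ω)`. -/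
noncomputable def cosLp (k : Fin 2 → ℕ) : L2 := scalarLp (cosMode k) (contDiff_cosMode k).continuous

/-- The class of the gradient of `cosMode k` in `L²(Ω; ℝ²)`. -/
noncomputable def cosGradLp (k : Fin 2 → ℕ) : L2Vec :=
  vecLp (classicalGrad (cosMode k)) (continuous_classicalGrad (contDiff_cosMode k))

theorem isWeakGradient_cosLp (k : Fin 2 → ℕ) : IsWeakGradient (cosLp k) (cosGradLp k) :=
  isWeakGradient_classicalGrad (contDiff_cosMode k)

theorem abs_sin_nat_mul_pi_le (n : ℕ) {t : ℝ} (ht : t ≤ 1) :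
    |Real.sin (Real.pi * n * t)| ≤ Real.pi * n * (1 - t) := by
  have e : Real.pi * n * t = n * Real.pi - Real.pi * n * (1 - t) := by ring
  rw [e, Real.sin_nat_mul_pi_sub, abs_neg, abs_mul, abs_pow, abs_neg, abs_one, one_pow, one_mul]
  refine Real.abs_sin_le_abs.trans (abs_of_nonneg ?_).le
  have := sub_nonneg.2 ht
  positivity

/-- Directional Green identity: `⟨∂ᵢ eₖ, ∂ᵢ w⟩ = (π kᵢ)² ⟨eₖ, w⟩`. -/
theorem IsWeakGradient.integral_coord_mul {w : L2} {g : L2Vec} (h : IsWeakGradient w g)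
    (k : Fin 2 → ℕ) (i : Fin 2) :
    ∫ x in Ω, g x i * fderiv ℝ (cosMode k) x (EuclideanSpace.single i 1)
      = (Real.pi * k i) ^ 2 * inner ℝ (cosLp k) w := by
  have hs (x : Plane) : |sinMode k i x| ≤ |Real.sin (Real.pi * k i * x i)| := by
    rw [sinMode_eq, abs_mul]
    exact mul_le_of_le_one_right (abs_nonneg _) (abs_cosCofactor_le_one k i x)
  have key := h.integral_fderiv_eq (contDiff_sinMode k i) i (L := Real.pi * k i) (by positivity)
    (fun x hx => (hs x).trans (Real.abs_sin_le_abs.trans (abs_of_nonneg (by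
      have := (hx i).1
      positivity)).le))
    (fun x hx => (hs x).trans (abs_sin_nat_mul_pi_le _ (hx i).2))
  simp only [fderiv_sinMode] at key
  rw [cosLp, inner_scalarLp]
  simp only [fderiv_cosMode]
  have e1 : ∫ x in Ω, g x i * (-(Real.pi * k i) * sinMode k i x)
      = -(Real.pi * k i) * ∫ x in Ω, g x i * sinMode k i x := by
    rw [← integral_const_mul]; congr 1; funext x; ring
  have e2 : ∫ x in Ω, w x * (Real.pi * k i * cosMode k x)
      = Real.pi * k i * ∫ x in Ω, w x * cosMode k x := by
    rw [← integral_const_mul]; congr 1; funext x; ring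
  rw [e2] at key
  rw [e1]
  linear_combination -(Real.pi * k i) * key

/-- The eigenvalue of the Neumann Laplacian at the mode `k`. -/
noncomputable def eigenvalue (k : Fin 2 → ℕ) : ℝ := ∑ i, (Real.pi * k i) ^ 2

theorem IsWeakGradient.inner_cosGradLp {w : L2} {g : L2Vec} (h : IsWeakGradient w g)
    (k : Fin 2 → ℕ) :
    inner ℝ (cosGradLp k) g = eigenvalue k * inner ℝ (cosLp k) w := by
  rw [cosGradLp, inner_vecLp, eigenvalue, Finset.sum_mul]
  simp only [← h.integral_coord_mul]
  rw [← integral_finsetSum]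
  · congr 1
  · intro i _
    obtain ⟨C, hC⟩ := isCompact_Ω.exists_bound_of_continuousOn
      (continuous_partial (contDiff_cosMode k) (EuclideanSpace.single i 1)).continuousOn
    exact (integrable_coord g i).mul_bdd (c := C)
      (continuous_partial (contDiff_cosMode k) _).aestronglyMeasurable
      ((ae_restrict_iff' measurableSet_Ω).2 (Filter.Eventually.of_forall hC))

/-- In a coordinate where `k` and `l` differ, the Green identity evaluates the same integral of
directional derivatives with the two distinct factors (π kᵢ)² and (π lᵢ)². -/
theorem inner_cosLp_of_ne {k l : Fin 2 → ℕ} (hkl : k ≠ l) : inner ℝ (cosLp k) (cosLp l) = 0 := by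
  obtain ⟨i, hi⟩ := Function.ne_iff.1 hkl
  have h (a b : Fin 2 → ℕ) : ∫ x in Ω, fderiv ℝ (cosMode b) x (EuclideanSpace.single i 1) *
      fderiv ℝ (cosMode a) x (EuclideanSpace.single i 1)
        = (Real.pi * a i) ^ 2 * inner ℝ (cosLp a) (cosLp b) := by
    rw [← (isWeakGradient_cosLp b).integral_coord_mul]
    refine integral_congr_ae ?_
    filter_upwards [coeFn_vecLp (continuous_classicalGrad (contDiff_cosMode b))] with x hx
    rw [cosGradLp, hx]; rfl
  have h3 : ((Real.pi * k i) ^ 2 - (Real.pi * l i) ^ 2) * inner ℝ (cosLp k) (cosLp l) = 0 := by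
    rw [sub_mul, sub_eq_zero, ← h k l, real_inner_comm, ← h l k]
    congr 1
    funext x
    exact mul_comm _ _
  refine (mul_eq_zero.1 h3).resolve_left fun h4 => hi ?_
  have h5 := (sq_eq_sq₀ (by positivity) (by positivity)).1 (sub_eq_zero.1 h4)
  exact_mod_cast mul_left_cancel₀ Real.pi_ne_zero h5

theorem nonempty_interior_Ω : (interior Ω).Nonempty :=
  ⟨WithLp.toLp 2 fun _ => 1 / 2, mem_interior_Ω.2 fun i => by norm_num⟩

/-- A continuous function vanishing almost everywhere on the square vanishes on all of it, and a
mode equals 1 at the origin. -/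
theorem cosLp_ne_zero (k : Fin 2 → ℕ) : cosLp k ≠ 0 := by
  intro h
  have h1 : cosMode k =ᵐ[volΩ] fun _ => 0 :=
    (coeFn_scalarLp (contDiff_cosMode k).continuous).symm.trans
      ((Filter.EventuallyEq.of_eq (by rw [← cosLp, h])).trans (Lp.coeFn_zero _ _ _))
  have h2 := Measure.eqOn_of_ae_eq h1 (contDiff_cosMode k).continuous.continuousOn
    continuousOn_const (by
      rw [convex_Ω.closure_interior_eq_closure_of_nonempty_interior nonempty_interior_Ω]
      exact subset_closure)
  have h3 : cosMode k 0 = 0 := h2 (fun i => by simp)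
  simp [cosMode, tensor] at h3

/-! ### Completeness of the cosine modes. -/

/-- The restriction of a mode to `Ω`. -/
noncomputable def cosModeOn (k : Fin 2 → ℕ) : C(Ω, ℝ) :=
  ⟨fun x => cosMode k x, (contDiff_cosMode k).continuous.comp continuous_subtype_val⟩

theorem cosMode_update (k : Fin 2 → ℕ) (i : Fin 2) (m : ℕ) (x : Plane) :
    cosMode (Function.update k i m) x = Real.cos (Real.pi * m * x i) * cosCofactor k i x := by
  rw [cosMode_eq _ i, Function.update_self, cosCofactor, cosCofactor]
  congr 1
  exact Finset.prod_congr rfl fun j hj => by rw [Function.update_of_ne (Finset.ne_of_mem_erase hj)]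

theorem cosMode_single (i : Fin 2) (x : Plane) :
    cosMode (Pi.single i 1) x = Real.cos (Real.pi * x i) := by
  have := cosMode_update 0 i 1 x
  simpa [cosCofactor, Pi.single] using this

/-- This is the product-to-sum formula for cosines. Frequency 0 is treated apart because kᵢ - 1 is
not a natural number there. -/
theorem single_mul_mem_span (i : Fin 2) (k : Fin 2 → ℕ) :
    cosModeOn (Pi.single i 1) * cosModeOn k ∈ Submodule.span ℝ (range cosModeOn) := by
  have hmem (l) : cosModeOn l ∈ Submodule.span ℝ (range cosModeOn) :=
    Submodule.subset_span (mem_range_self l)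
  rcases Nat.eq_zero_or_eq_succ_pred (k i) with h | h
  · convert hmem (Function.update k i 1) using 1
    ext x
    change cosMode (Pi.single i 1) x * cosMode k x = cosMode (Function.update k i 1) x
    rw [cosMode_single, cosMode_update, cosMode_eq k i, h]
    simp
  · obtain ⟨m, hm⟩ : ∃ m, k i = m + 1 := ⟨_, h⟩
    convert Submodule.smul_mem _ (1 / 2 : ℝ) (Submodule.add_mem _
      (hmem (Function.update k i (m + 2))) (hmem (Function.update k i m))) using 1
    ext x
    change cosMode (Pi.single i 1) x * cosMode k x = (1 / 2 : ℝ) *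
      (cosMode (Function.update k i (m + 2)) x + cosMode (Function.update k i m) x)
    rw [cosMode_single, cosMode_update, cosMode_update, cosMode_eq k i, hm]
    have e1 : Real.pi * ((m + 2 : ℕ) : ℝ) * x.1 i
      = Real.pi * ((m + 1 : ℕ) : ℝ) * x.1 i + Real.pi * x.1 i := by push_cast; ring
    have e2 : Real.pi * (m : ℝ) * x.1 i
      = Real.pi * ((m + 1 : ℕ) : ℝ) * x.1 i - Real.pi * x.1 i := by push_cast; ring
    rw [e1, e2, Real.cos_add, Real.cos_sub]
    ring

theorem cosModeOn_zero : cosModeOn 0 = 1 := by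
  ext x
  change cosMode 0 x = 1
  simp [cosMode, tensor]

/-- Linear combinations of modes are uniformly dense in the continuous functions on `Ω`. -/
theorem dense_span_cosModeOn :
    Dense (Submodule.span ℝ (range cosModeOn) : Set C(Ω, ℝ)) := by
  let A : Subalgebra ℝ C(Ω, ℝ) := Algebra.adjoin ℝ (range fun i : Fin 2 => cosModeOn (Pi.single i 1))
  have : CompactSpace Ω := isCompact_iff_compactSpace.1 isCompact_Ω
  have hsep : A.SeparatesPoints := by
    intro x y hxy
    obtain ⟨i, hi⟩ : ∃ i, x.1 i ≠ y.1 i := by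
      by_contra! hn
      exact hxy (Subtype.ext (by ext i; exact hn i))
    refine ⟨_, ⟨cosModeOn (Pi.single i 1), Algebra.subset_adjoin (mem_range_self i), rfl⟩, ?_⟩
    change cosMode (Pi.single i 1) x ≠ cosMode (Pi.single i 1) y
    rw [cosMode_single, cosMode_single]
    intro h
    have hx := x.2 i
    have hy := y.2 i
    have hp := Real.pi_pos
    refine hi (mul_left_cancel₀ hp.ne' (Real.injOn_cos ⟨?_, ?_⟩ ⟨?_, ?_⟩ h))
    · exact mul_nonneg hp.le hx.1
    · exact mul_le_of_le_one_right hp.le hx.2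
    · exact mul_nonneg hp.le hy.1
    · exact mul_le_of_le_one_right hp.le hy.2
  -- The span is stable under multiplication by the generators of `A`, hence by `A`. As it contains
  -- 1, it contains `A`, which is dense.
  have hA : ∀ a ∈ A, ∀ b ∈ Submodule.span ℝ (range cosModeOn),
      a * b ∈ Submodule.span ℝ (range cosModeOn) := by
    intro a ha
    refine Algebra.adjoin_induction (p := fun a _ => ∀ b ∈ Submodule.span ℝ (range cosModeOn),
      a * b ∈ Submodule.span ℝ (range cosModeOn)) ?_ ?_ ?_ ?_ ha
    · rintro _ ⟨i, rfl⟩ b hb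
      refine Submodule.span_induction ?_ ?_ ?_ ?_ hb
      · rintro _ ⟨k, rfl⟩
        exact single_mul_mem_span i k
      · simp
      · intro p q _ _ hp hq
        rw [mul_add]; exact Submodule.add_mem _ hp hq
      · intro c p _ hp
        rw [mul_smul_comm]; exact Submodule.smul_mem _ _ hp
    · intro r b hb
      rw [← Algebra.smul_def]; exact Submodule.smul_mem _ _ hb
    · intro p q _ _ hp hq b hb
      rw [add_mul]; exact Submodule.add_mem _ (hp b hb) (hq b hb)
    · intro p q _ _ hp hq b hb
      rw [mul_assoc]; exact hp _ (hq b hb)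
  have hd : Dense (A : Set C(Ω, ℝ)) := by
    rw [dense_iff_closure_eq, ← Subalgebra.topologicalClosure_coe,
      ContinuousMap.subalgebra_topologicalClosure_eq_top_of_separatesPoints A hsep]
    rfl
  refine hd.mono fun a ha => ?_
  have h1 : (1 : C(Ω, ℝ)) ∈ Submodule.span ℝ (range cosModeOn) := by
    rw [← cosModeOn_zero]; exact Submodule.subset_span (mem_range_self 0)
  simpa using hA a ha 1 h1

/-- Transfers a combination of modes from C(Ω) to L², where classes are formed from functions on the
whole plane. -/
theorem exists_scalarLp_mem_span {s : C(Ω, ℝ)} (hs : s ∈ Submodule.span ℝ (range cosModeOn)) :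
    ∃ (F : Plane → ℝ) (hF : Continuous F), (∀ x : Ω, F x = s x) ∧
      scalarLp F hF ∈ Submodule.span ℝ (range cosLp) := by
  refine Submodule.span_induction ?_ ?_ ?_ ?_ hs
  · rintro _ ⟨k, rfl⟩
    exact ⟨cosMode k, (contDiff_cosMode k).continuous, fun _ => rfl,
      Submodule.subset_span (mem_range_self k)⟩
  · refine ⟨fun _ => 0, continuous_const, fun _ => rfl, ?_⟩
    have : scalarLp (fun _ => 0) continuous_const = 0 := MemLp.toLp_zero _
    rw [this]; exact Submodule.zero_mem _
  · rintro p q _ _ ⟨F, hF, h1, h2⟩ ⟨G, hG, h3, h4⟩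
    exact ⟨fun x => F x + G x, hF.add hG, fun x => by simp [h1, h3], Submodule.add_mem _ h2 h4⟩
  · rintro c p _ ⟨F, hF, h1, h2⟩
    exact ⟨fun x => c * F x, hF.const_mul c, fun x => by simp [h1], Submodule.smul_mem _ c h2⟩

/-- The modes are complete in `L²(Ω)`. -/
theorem span_cosLp_topologicalClosure :
    ⊤ ≤ (Submodule.span ℝ (range cosLp)).topologicalClosure := by
  have : CompactSpace Ω := isCompact_iff_compactSpace.1 isCompact_Ω
  intro u _
  rw [← SetLike.mem_coe, Submodule.topologicalClosure_coe]
  refine closure_minimal ?_ isClosed_closure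
    ((BoundedContinuousFunction.toLp_denseRange ℝ volΩ ℝ (p := 2) (by norm_num)) u)
  rintro _ ⟨f, rfl⟩
  have hf : BoundedContinuousFunction.toLp 2 volΩ ℝ f = scalarLp f f.continuous := rfl
  rw [hf, Metric.mem_closure_iff]
  intro ε hε
  set C : ℝ := (measureUnivNNReal volΩ : ℝ) ^ (2 : ENNReal).toReal⁻¹ with hC
  have hC0 : 0 ≤ C := by positivity
  -- Here `C` is the factor from the sup norm to the L² norm. Dividing by C + 1 makes the final
  -- inequality strict.
  obtain ⟨s, hs, hsf⟩ := Metric.mem_closure_iff.1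
    (dense_span_cosModeOn (f.toContinuousMap.restrict Ω)) (ε / (C + 1)) (by positivity)
  obtain ⟨F, hF, h1, h2⟩ := exists_scalarLp_mem_span hs
  refine ⟨_, h2, ?_⟩
  have hb : ‖scalarLp f f.continuous - scalarLp F hF‖ ≤ C * (ε / (C + 1)) := by
    refine Lp.norm_le_of_ae_bound (by positivity) ?_
    filter_upwards [Lp.coeFn_sub (scalarLp f f.continuous) (scalarLp F hF),
      coeFn_scalarLp f.continuous, coeFn_scalarLp hF, ae_mem_interior_Ω] with x e1 e2 e3 hx
    rw [e1, Pi.sub_apply, e2, e3, h1 ⟨x, interior_subset hx⟩]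
    exact ((ContinuousMap.dist_apply_le_dist (⟨x, interior_subset hx⟩ : Ω)).trans_lt hsf).le
  rw [dist_eq_norm]
  refine hb.trans_lt ?_
  rw [mul_div_assoc', div_lt_iff₀ (by positivity)]
  nlinarith

/-! ### The L¹ norm on square integrable fields. -/

/-- The `L¹` norm of a square integrable vector field. -/
noncomputable def l1Norm (g : L2Vec) : ℝ := ∫ x in Ω, ‖g x‖

theorem integrable_norm (g : L2Vec) : Integrable (fun x => ‖g x‖) volΩ :=
  ((Lp.memLp g).integrable (by norm_num)).norm

theorem l1Norm_add_le (g h : L2Vec) : l1Norm (g + h) ≤ l1Norm g + l1Norm h := by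
  rw [l1Norm, l1Norm, l1Norm, ← integral_add (integrable_norm g) (integrable_norm h)]
  refine integral_mono_ae (integrable_norm _) ((integrable_norm g).add (integrable_norm h)) ?_
  filter_upwards [Lp.coeFn_add g h] with x hx
  rw [hx]; exact norm_add_le _ _

theorem l1Norm_smul (c : ℝ) (g : L2Vec) : l1Norm (c • g) = |c| * l1Norm g := by
  rw [l1Norm, l1Norm, ← integral_const_mul]
  refine integral_congr_ae ?_
  filter_upwards [Lp.coeFn_smul c g] with x hx
  rw [hx, Pi.smul_apply, norm_smul, Real.norm_eq_abs]

theorem l1Norm_vecLp {f : Plane → Plane} (hf : Continuous f) :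
    l1Norm (vecLp f hf) = ∫ x in Ω, ‖f x‖ := by
  refine integral_congr_ae ?_
  filter_upwards [coeFn_vecLp hf] with x hx
  rw [hx]

/-- Cauchy–Schwarz against the constant 1, the measure being finite. -/
theorem exists_l1Norm_le : ∃ C : ℝ, 0 ≤ C ∧ ∀ g : L2Vec, l1Norm g ≤ C * ‖g‖ := by
  refine ⟨‖scalarLp (fun _ => 1) continuous_const‖, norm_nonneg _, fun g => ?_⟩
  have hm : MemLp (fun x => ‖g x‖) 2 volΩ := (Lp.memLp g).norm
  have h1 : l1Norm g = inner ℝ (scalarLp (fun _ => 1) continuous_const) (hm.toLp _) := by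
    rw [inner_scalarLp]
    refine integral_congr_ae ?_
    filter_upwards [hm.coeFn_toLp] with x hx
    rw [hx, mul_one]
  have h2 : ‖hm.toLp _‖ = ‖g‖ := by
    rw [Lp.norm_toLp, Lp.norm_def, eLpNorm_norm]
  rw [h1, ← h2]
  exact real_inner_le_norm _ _

theorem continuous_l1Norm : Continuous l1Norm := by
  obtain ⟨C, hC0, hC⟩ := exists_l1Norm_le
  refine (LipschitzWith.of_le_add_mul (K := ⟨C, hC0⟩) fun g h => ?_).continuous
  rw [dist_eq_norm]
  have := l1Norm_add_le h (g - h)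
  rw [add_sub_cancel] at this
  exact this.trans (add_le_add_right (hC _) _)

/-! ### Averages of shifts contract the L¹ norm of gradients. -/

/-- The point with `i`-th coordinate `s` and remaining coordinate `y`. -/
noncomputable def linePoint (i : Fin 2) (y : Fin 1 → ℝ) (s : ℝ) : Plane :=
  WithLp.toLp 2 (i.insertNth (α := fun _ => ℝ) s y)

theorem linePoint_self (i : Fin 2) (y : Fin 1 → ℝ) (s : ℝ) : linePoint i y s i = s := by
  simp [linePoint]

theorem linePoint_of_ne {i j : Fin 2} (h : j ≠ i) (y : Fin 1 → ℝ) (s t : ℝ) :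
    linePoint i y s j = linePoint i y t j := by
  obtain ⟨l, rfl⟩ := Fin.exists_succAbove_eq h
  simp [linePoint]

theorem continuous_linePoint (i : Fin 2) :
    Continuous fun p : (Fin 1 → ℝ) × ℝ => linePoint i p.1 p.2 :=
  (PiLp.continuous_toLp 2 _).comp (Continuous.finInsertNth i continuous_snd continuous_fst)

/-- Fubini's theorem on the square, with the `i`-th coordinate as inner variable. -/
theorem setIntegral_Ω_eq {F : Plane → ℝ} (hF : Continuous F) (i : Fin 2) :
    ∫ x in Ω, F x = ∫ y in (Set.univ.pi fun _ : Fin 1 => Icc (0 : ℝ) 1),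
      ∫ s in (0 : ℝ)..1, F (linePoint i y s) := by
  let e : ℝ × (Fin 1 → ℝ) ≃ᵐ Plane :=
    (MeasurableEquiv.piFinSuccAbove (fun _ : Fin 2 => ℝ) i).symm.trans
      (MeasurableEquiv.toLp 2 (Fin 2 → ℝ))
  have he : MeasurePreserving e :=
    ((volume_preserving_piFinSuccAbove (fun _ : Fin 2 => ℝ) i).symm _).trans
      (PiLp.volume_preserving_toLp (Fin 2))
  have hval (p : ℝ × (Fin 1 → ℝ)) : e p = linePoint i p.2 p.1 := rfl
  have hpre : e ⁻¹' Ω = Icc (0 : ℝ) 1 ×ˢ (Set.univ.pi fun _ : Fin 1 => Icc (0 : ℝ) 1) := by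
    ext p
    rw [mem_preimage, hval, mem_prod, Set.mem_univ_pi]
    change (∀ j, linePoint i p.2 p.1 j ∈ Icc (0 : ℝ) 1) ↔ _
    rw [Fin.forall_iff_succAbove i, linePoint_self]
    simp [linePoint]
  have hcont : Continuous fun p : ℝ × (Fin 1 → ℝ) => F (linePoint i p.2 p.1) :=
    hF.comp ((continuous_linePoint i).comp continuous_swap)
  rw [← he.setIntegral_preimage_emb e.measurableEmbedding, hpre]
  simp only [hval]
  have hint : IntegrableOn (fun p : ℝ × (Fin 1 → ℝ) => F (linePoint i p.2 p.1))
      (Icc (0 : ℝ) 1 ×ˢ (Set.univ.pi fun _ : Fin 1 => Icc (0 : ℝ) 1)) (volume.prod volume) :=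
    hcont.continuousOn.integrableOn_compact
      (isCompact_Icc.prod (isCompact_univ_pi fun _ => isCompact_Icc))
  rw [IntegrableOn, ← Measure.prod_restrict] at hint
  rw [Measure.volume_eq_prod, ← Measure.prod_restrict, integral_prod_symm _ hint]
  congr 1
  funext y
  rw [intervalIntegral.integral_of_le zero_le_one, integral_Icc_eq_integral_Ioc]

/-- The average of two opposite shifts preserves the integral over a half-period of an even
periodic function. -/
theorem integral_shift_add_shift {f : ℝ → ℝ} (hf : Continuous f) (heven : ∀ s, f (-s) = f s)
    (hper : Function.Periodic f 2) (h : ℝ) :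
    ∫ s in (0 : ℝ)..1, (f (s + h) + f (s - h)) = 2 * ∫ s in (0 : ℝ)..1, f s := by
  have hi (a b : ℝ) : IntervalIntegrable f volume a b := hf.intervalIntegrable a b
  -- Reflection moves the second shift to [-1, 0], so both shifts together integrate f(s + h) over
  -- the full period [-1, 1], where translation has no effect.
  have e1 : ∫ s in (0 : ℝ)..1, f (s - h) = ∫ s in (-1 : ℝ)..0, f (s + h) := by
    have := intervalIntegral.integral_comp_neg (a := -1) (b := 0) fun s => f (s - h)
    rw [neg_zero, neg_neg] at this
    rw [← this]
    refine intervalIntegral.integral_congr fun s _ => ?_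
    rw [← heven]; congr 1; ring
  have e2 : ∫ s in (-1 : ℝ)..0, f s = ∫ s in (0 : ℝ)..1, f s := by
    have := intervalIntegral.integral_comp_neg (a := -1) (b := 0) f
    rw [neg_zero, neg_neg] at this
    rw [← this]
    exact intervalIntegral.integral_congr fun s _ => (heven s).symm
  have hc : Continuous fun s => f (s + h) := hf.comp (by fun_prop)
  have hc' : Continuous fun s => f (s - h) := hf.comp (by fun_prop)
  rw [intervalIntegral.integral_add (hc.intervalIntegrable _ _) (hc'.intervalIntegrable _ _), e1, add_comm,
    intervalIntegral.integral_add_adjacent_intervals (hc.intervalIntegrable _ _)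
      (hc.intervalIntegrable _ _), intervalIntegral.integral_comp_add_right]
  have e3 := hper.intervalIntegral_add_eq (-1 + h) (-1)
  rw [show (-1 + h + 2 : ℝ) = 1 + h by ring, show (-1 + 2 : ℝ) = 1 by ring] at e3
  rw [e3, ← intervalIntegral.integral_add_adjacent_intervals (hi _ 0) (hi _ _), e2]
  ring

/-- If `Fh` is bounded along every line in direction `i` by the average of the shifts by `±h` of
`F`, and `F` is even and periodic in that direction, then `∫ Fh ≤ ∫ F` on the square. -/
theorem setIntegral_le_of_le_shift {F Fh : Plane → ℝ} (hF : Continuous F) (hFh : Continuous Fh)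
    (i : Fin 2) (h : ℝ) (heven : ∀ y s, F (linePoint i y (-s)) = F (linePoint i y s))
    (hper : ∀ y s, F (linePoint i y (s + 2)) = F (linePoint i y s))
    (hle : ∀ y s, 2 * Fh (linePoint i y s) ≤
      F (linePoint i y (s + h)) + F (linePoint i y (s - h))) :
    ∫ x in Ω, Fh x ≤ ∫ x in Ω, F x := by
  have hc {H : Plane → ℝ} (hH : Continuous H) : IntegrableOn
      (fun y => ∫ s in (0 : ℝ)..1, H (linePoint i y s))
      (Set.univ.pi fun _ : Fin 1 => Icc (0 : ℝ) 1) :=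
    (intervalIntegral.continuous_parametric_intervalIntegral_of_continuous'
      (f := fun y s => H (linePoint i y s)) (hH.comp (continuous_linePoint i)) 0 1
      ).continuousOn.integrableOn_compact (isCompact_univ_pi fun _ => isCompact_Icc)
  have hl (y : Fin 1 → ℝ) : Continuous (linePoint i y) :=
    (continuous_linePoint i).comp (by fun_prop : Continuous fun s : ℝ => (y, s))
  rw [setIntegral_Ω_eq hF i, setIntegral_Ω_eq hFh i]
  refine integral_mono (hc hFh) (hc hF) fun y => ?_
  change ∫ s in (0 : ℝ)..1, Fh (linePoint i y s) ≤ ∫ s in (0 : ℝ)..1, F (linePoint i y s)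
  have hFy : Continuous fun s => F (linePoint i y s) := hF.comp (hl y)
  have key := integral_shift_add_shift hFy (heven y) (hper y) h
  have hmono : ∫ s in (0 : ℝ)..1, 2 * Fh (linePoint i y s) ≤
      ∫ s in (0 : ℝ)..1, (F (linePoint i y (s + h)) + F (linePoint i y (s - h))) := by
    refine intervalIntegral.integral_mono zero_le_one ?_ ?_ (hle y)
    · exact ((hFh.comp (hl y)).const_mul 2).intervalIntegrable _ _
    · exact ((hFy.comp (by fun_prop : Continuous fun s => s + h)).add
        (hFy.comp (by fun_prop : Continuous fun s => s - h))).intervalIntegrable _ _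
  rw [intervalIntegral.integral_const_mul] at hmono
  linarith

/-- The gradient of a mode along a line in direction `i`. -/
theorem exists_classicalGrad_cosMode_linePoint (k : Fin 2 → ℕ) (i : Fin 2) (y : Fin 1 → ℝ) :
    ∃ D : Fin 2 → ℝ, ∀ s j, classicalGrad (cosMode k) (linePoint i y s) j =
      D j * if j = i then Real.sin (Real.pi * k i * s) else Real.cos (Real.pi * k i * s) := by
  have h (j : Fin 2) : ∃ d : ℝ, ∀ s, classicalGrad (cosMode k) (linePoint i y s) j =
      d * if j = i then Real.sin (Real.pi * k i * s) else Real.cos (Real.pi * k i * s) := by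
    have hg (s : ℝ) : classicalGrad (cosMode k) (linePoint i y s) j =
      -(Real.pi * k j) * sinMode k j (linePoint i y s) := fderiv_cosMode k j _
    rcases eq_or_ne j i with rfl | hj
    · refine ⟨-(Real.pi * k j) * cosCofactor k j (linePoint j y 0), fun s => ?_⟩
      have hco : cosCofactor k j (linePoint j y s) = cosCofactor k j (linePoint j y 0) :=
        Finset.prod_congr rfl fun l hl => by
          rw [linePoint_of_ne (Finset.ne_of_mem_erase hl) y s 0]
      rw [hg, sinMode_eq, linePoint_self, hco, if_pos rfl]
      ring
    · refine ⟨-(Real.pi * k j) * (Real.sin (Real.pi * k j * linePoint i y 0 j) *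
        ∏ l ∈ (Finset.univ.erase j).erase i, Real.cos (Real.pi * k l * linePoint i y 0 l)),
        fun s => ?_⟩
      have hco : cosCofactor k j (linePoint i y s) = Real.cos (Real.pi * k i * s) *
          ∏ l ∈ (Finset.univ.erase j).erase i,
            Real.cos (Real.pi * k l * linePoint i y 0 l) := by
        rw [cosCofactor, ← Finset.mul_prod_erase _ _
          (Finset.mem_erase.2 ⟨hj.symm, Finset.mem_univ i⟩), linePoint_self]
        congr 1
        exact Finset.prod_congr rfl fun l hl => by
          rw [linePoint_of_ne (Finset.ne_of_mem_erase hl) y s 0]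
      rw [hg, sinMode_eq, hco, linePoint_of_ne hj y s 0, if_neg hj]
      ring
  choose D hD using h
  exact ⟨D, fun s j => hD j s⟩

/-- The gradient of a finite cosine sum. -/
noncomputable def cosSumGrad (F : Finset (Fin 2 → ℕ)) (a : (Fin 2 → ℕ) → ℝ) (x : Plane) : Plane :=
  ∑ k ∈ F, a k • classicalGrad (cosMode k) x

theorem continuous_cosSumGrad (F : Finset (Fin 2 → ℕ)) (a : (Fin 2 → ℕ) → ℝ) :
    Continuous (cosSumGrad F a) :=
  continuous_finsetSum _ fun k _ =>
    (continuous_classicalGrad (contDiff_cosMode k)).const_smul (a k)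

theorem sum_smul_cosGradLp (F : Finset (Fin 2 → ℕ)) (a : (Fin 2 → ℕ) → ℝ) :
    ∑ k ∈ F, a k • cosGradLp k = vecLp (cosSumGrad F a) (continuous_cosSumGrad F a) := by
  classical
  induction F using Finset.induction_on with
  | empty => exact (MemLp.toLp_zero _).symm
  | insert k F hk ih =>
    rw [Finset.sum_insert hk, ih]
    have : cosSumGrad (insert k F) a
        = fun x => a k • classicalGrad (cosMode k) x + cosSumGrad F a x := by
      funext x; rw [cosSumGrad, Finset.sum_insert hk]; rfl
    simp only [this]
    rfl

theorem cosSumGrad_apply (F : Finset (Fin 2 → ℕ)) (a : (Fin 2 → ℕ) → ℝ) (x : Plane) (j : Fin 2) :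
    cosSumGrad F a x j = ∑ k ∈ F, a k * classicalGrad (cosMode k) x j := by
  simp [cosSumGrad]

/-- Multiplying the coefficients of a cosine sum by `cos (π kᵢ h)`, that is, averaging its shifts
by `±h` in direction `i`, does not increase the `L¹` norm of its gradient. -/
theorem l1Norm_sum_cos_mul_le (F : Finset (Fin 2 → ℕ)) (a : (Fin 2 → ℕ) → ℝ) (i : Fin 2) (h : ℝ) :
    l1Norm (∑ k ∈ F, (Real.cos (Real.pi * k i * h) * a k) • cosGradLp k)
      ≤ l1Norm (∑ k ∈ F, a k • cosGradLp k) := by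
  rw [sum_smul_cosGradLp F a, sum_smul_cosGradLp F fun k => Real.cos (Real.pi * k i * h) * a k,
    l1Norm_vecLp, l1Norm_vecLp]
  refine setIntegral_le_of_le_shift (continuous_cosSumGrad F a).norm
    (continuous_cosSumGrad F _).norm i h (fun y s => ?_) (fun y s => ?_) (fun y s => ?_)
  -- Along the line the i-th component of the gradient is odd and the other is even, so the norm is
  -- even.
  · rw [EuclideanSpace.norm_eq, EuclideanSpace.norm_eq]
    congr 1
    refine Finset.sum_congr rfl fun j _ => ?_
    have hj : cosSumGrad F a (linePoint i y (-s)) j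
        = (if j = i then -1 else 1) * cosSumGrad F a (linePoint i y s) j := by
      rw [cosSumGrad_apply, cosSumGrad_apply, Finset.mul_sum]
      refine Finset.sum_congr rfl fun k _ => ?_
      obtain ⟨D, hD⟩ := exists_classicalGrad_cosMode_linePoint k i y
      rw [hD, hD]
      split_ifs
      · rw [mul_neg, Real.sin_neg]; ring
      · rw [mul_neg, Real.cos_neg]; ring
    rw [hj]
    split_ifs <;> simp
  · congr 1
    ext j
    rw [cosSumGrad_apply, cosSumGrad_apply]
    refine Finset.sum_congr rfl fun k _ => ?_
    obtain ⟨D, hD⟩ := exists_classicalGrad_cosMode_linePoint k i y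
    rw [hD, hD, show Real.pi * k i * (s + 2) = Real.pi * k i * s + k i * (2 * Real.pi) by ring,
      Real.sin_add_nat_mul_two_pi, Real.cos_add_nat_mul_two_pi]
  -- The addition formulas hold alike for sine and cosine, so the same multiplier averages both
  -- components.
  · have e : (2 : ℝ) • cosSumGrad F (fun k => Real.cos (Real.pi * k i * h) * a k) (linePoint i y s)
        = cosSumGrad F a (linePoint i y (s + h)) + cosSumGrad F a (linePoint i y (s - h)) := by
      ext j
      rw [PiLp.add_apply, PiLp.smul_apply, cosSumGrad_apply, cosSumGrad_apply, cosSumGrad_apply,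
        ← Finset.sum_add_distrib, smul_eq_mul, Finset.mul_sum]
      refine Finset.sum_congr rfl fun k _ => ?_
      obtain ⟨D, hD⟩ := exists_classicalGrad_cosMode_linePoint k i y
      rw [hD, hD, hD, mul_add, mul_sub]
      split_ifs
      · rw [Real.sin_add, Real.sin_sub]; ring
      · rw [Real.cos_add, Real.cos_sub]; ring
    rw [← Real.norm_two, ← norm_smul, e]
    exact norm_add_le _ _

/-! ### H¹ in the cosine basis. -/

theorem orthonormal_normalized_cosLp : Orthonormal ℝ fun k => ‖cosLp k‖⁻¹ • cosLp k := by
  refine ⟨fun k => ?_, fun k l hkl => ?_⟩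
  · rw [norm_smul, norm_inv, norm_norm, inv_mul_cancel₀ (norm_ne_zero_iff.2 (cosLp_ne_zero k))]
  · change inner ℝ (‖cosLp k‖⁻¹ • cosLp k) (‖cosLp l‖⁻¹ • cosLp l) = 0
    rw [real_inner_smul_left, real_inner_smul_right, inner_cosLp_of_ne hkl, mul_zero, mul_zero]

theorem span_normalized_cosLp_topologicalClosure :
    ⊤ ≤ (Submodule.span ℝ (range fun k => ‖cosLp k‖⁻¹ • cosLp k)).topologicalClosure := by
  refine span_cosLp_topologicalClosure.trans (Submodule.topologicalClosure_mono
    (Submodule.span_le.2 ?_))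
  rintro _ ⟨k, rfl⟩
  have h := Submodule.smul_mem _ ‖cosLp k‖ (Submodule.subset_span
    (mem_range_self (f := fun k => ‖cosLp k‖⁻¹ • cosLp k) k) :
    _ ∈ Submodule.span ℝ (range fun k => ‖cosLp k‖⁻¹ • cosLp k))
  simp only [smul_smul] at h
  rwa [mul_inv_cancel₀ (norm_ne_zero_iff.2 (cosLp_ne_zero k)), one_smul] at h

/-- The Hilbert basis of `L²(Ω)` of normalized Neumann eigenfunctions. -/
noncomputable def cosBasis : HilbertBasis (Fin 2 → ℕ) ℝ L2 :=
  HilbertBasis.mk orthonormal_normalized_cosLp span_normalized_cosLp_topologicalClosure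

theorem cosBasis_apply (k : Fin 2 → ℕ) : cosBasis k = ‖cosLp k‖⁻¹ • cosLp k := by
  rw [cosBasis, HilbertBasis.coe_mk]

/-- The gradients of the normalized eigenfunctions. -/
noncomputable def basisGrad (k : Fin 2 → ℕ) : L2Vec := ‖cosLp k‖⁻¹ • cosGradLp k

theorem basis_mem_gradGraph (k : Fin 2 → ℕ) : (cosBasis k, basisGrad k) ∈ gradGraph := by
  rw [cosBasis_apply, basisGrad]
  exact gradGraph.smul_mem ‖cosLp k‖⁻¹ (mem_gradGraph.2 (isWeakGradient_cosLp k))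

theorem IsWeakGradient.inner_basisGrad {w : L2} {g : L2Vec} (h : IsWeakGradient w g)
    (k : Fin 2 → ℕ) :
    inner ℝ (basisGrad k) g = eigenvalue k * inner ℝ (cosBasis k) w := by
  rw [cosBasis_apply, basisGrad, real_inner_smul_left, real_inner_smul_left, h.inner_cosGradLp]
  ring

theorem inner_basisGrad_basisGrad (k l : Fin 2 → ℕ) :
    inner ℝ (basisGrad k) (basisGrad l) = eigenvalue k * inner ℝ (cosBasis k) (cosBasis l) :=
  (mem_gradGraph.1 (basis_mem_gradGraph l)).inner_basisGrad k

theorem eigenvalue_nonneg (k : Fin 2 → ℕ) : 0 ≤ eigenvalue k :=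
  Finset.sum_nonneg fun _ _ => sq_nonneg _

theorem inner_basisGrad_of_ne {k l : Fin 2 → ℕ} (h : k ≠ l) :
    inner ℝ (basisGrad k) (basisGrad l) = 0 := by
  rw [inner_basisGrad_basisGrad, cosBasis.orthonormal.2 h, mul_zero]

theorem norm_basisGrad_sq (k : Fin 2 → ℕ) : ‖basisGrad k‖ ^ 2 = eigenvalue k := by
  rw [← real_inner_self_eq_norm_sq, inner_basisGrad_basisGrad, real_inner_self_eq_norm_sq,
    cosBasis.orthonormal.1 k]
  ring

theorem sum_mem_gradGraph (F : Finset (Fin 2 → ℕ)) (c : (Fin 2 → ℕ) → ℝ) :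
    (∑ k ∈ F, c k • cosBasis k, ∑ k ∈ F, c k • basisGrad k) ∈ gradGraph := by
  have : (∑ k ∈ F, c k • cosBasis k, ∑ k ∈ F, c k • basisGrad k)
      = ∑ k ∈ F, c k • (cosBasis k, basisGrad k) := by
    simp [Prod.ext_iff, Prod.fst_sum, Prod.snd_sum]
  rw [this]
  exact Submodule.sum_mem _ fun k _ => Submodule.smul_mem _ _ (basis_mem_gradGraph k)

/-- A function with finite Dirichlet energy in the cosine basis is in `H¹(Ω)`, and its gradient is
computed termwise. -/
theorem exists_isWeakGradient_of_summable {u : L2}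
    (hu : Summable fun k => eigenvalue k * inner ℝ (cosBasis k) u ^ 2) :
    ∃ g : L2Vec, IsWeakGradient u g ∧
      HasSum (fun k => (inner ℝ (cosBasis k) u : ℝ) • basisGrad k) g := by
  -- Lines are used instead of an orthonormal family because the gradient of the constant mode is
  -- zero and cannot be normalized.
  have hV : OrthogonalFamily ℝ (fun k => (ℝ ∙ basisGrad k : Submodule ℝ L2Vec))
      fun k => (ℝ ∙ basisGrad k : Submodule ℝ L2Vec).subtypeₗᵢ := by
    refine OrthogonalFamily.of_pairwise fun k l hkl => ?_
    change (ℝ ∙ basisGrad k) ⟂ (ℝ ∙ basisGrad l)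
    rw [Submodule.isOrtho_span]
    rintro _ rfl _ rfl
    exact inner_basisGrad_of_ne hkl
  have hs := (hV.summable_iff_norm_sq_summable fun k =>
    ⟨(inner ℝ (cosBasis k) u : ℝ) • basisGrad k,
      Submodule.smul_mem _ _ (Submodule.mem_span_singleton_self _)⟩).2 (by
    refine hu.congr fun k => ?_
    rw [Submodule.coe_norm, norm_smul, mul_pow, norm_basisGrad_sq, Real.norm_eq_abs, sq_abs,
      mul_comm])
  obtain ⟨g, hg⟩ := hs
  have hg' : HasSum (fun k => (inner ℝ (cosBasis k) u : ℝ) • basisGrad k) g := hg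
  refine ⟨g, ?_, hg'⟩
  rw [← mem_gradGraph]
  have hb : HasSum (fun k => (inner ℝ (cosBasis k) u : ℝ) • cosBasis k) u := by
    simpa only [cosBasis.repr_apply_apply] using cosBasis.hasSum_repr u
  exact isClosed_gradGraph.mem_of_tendsto (hb.prodMk_nhds hg')
    (Filter.Eventually.of_forall fun F => sum_mem_gradGraph F _)

/-- A Bessel inequality: every partial sum S of the gradient series satisfies ⟨S, g⟩ = ‖S‖², hence
‖S‖ ≤ ‖g‖. -/
theorem IsWeakGradient.summable {w : L2} {g : L2Vec} (h : IsWeakGradient w g) :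
    Summable fun k => eigenvalue k * inner ℝ (cosBasis k) w ^ 2 := by
  refine summable_of_sum_le (c := ‖g‖ ^ 2)
    (fun k => mul_nonneg (eigenvalue_nonneg k) (sq_nonneg _)) fun F => ?_
  set S : L2Vec := ∑ k ∈ F, (inner ℝ (cosBasis k) w : ℝ) • basisGrad k with hS
  have h1 : inner ℝ S g = ∑ k ∈ F, eigenvalue k * inner ℝ (cosBasis k) w ^ 2 := by
    rw [hS, sum_inner]
    refine Finset.sum_congr rfl fun k _ => ?_
    rw [real_inner_smul_left, h.inner_basisGrad]
    ring
  have h2 : inner ℝ S S = ∑ k ∈ F, eigenvalue k * inner ℝ (cosBasis k) w ^ 2 := by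
    conv_lhs => rw [hS]
    rw [sum_inner]
    refine Finset.sum_congr rfl fun k hk => ?_
    rw [inner_sum, Finset.sum_eq_single k, real_inner_smul_left, real_inner_smul_right,
      real_inner_self_eq_norm_sq, norm_basisGrad_sq]
    · ring
    · intro l _ hl
      rw [real_inner_smul_left, real_inner_smul_right, inner_basisGrad_of_ne hl.symm]
      ring
    · exact fun hn => absurd hk hn
  rw [real_inner_self_eq_norm_sq] at h2
  have h3 := real_inner_le_norm S g
  rw [h1, ← h2] at h3
  rw [← h2]
  nlinarith [norm_nonneg S, norm_nonneg g, sq_nonneg (‖S‖ - ‖g‖)]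

theorem IsWeakGradient.hasSum {w : L2} {g : L2Vec} (h : IsWeakGradient w g) :
    HasSum (fun k => (inner ℝ (cosBasis k) w : ℝ) • basisGrad k) g := by
  obtain ⟨g', h1, h2⟩ := exists_isWeakGradient_of_summable h.summable
  rwa [h.unique h1]

/-! ### The dual ball and its invariance under averaged shifts. -/

/-- The subdifferential at `0` of the total variation: the `f` with `∫ f w ≤ ∫ |∇w|`. -/
def dualBall : Set L2 := {f | ∀ w g, IsWeakGradient w g → inner ℝ f w ≤ l1Norm g}

theorem l1Norm_nonneg (g : L2Vec) : 0 ≤ l1Norm g := integral_nonneg fun _ => norm_nonneg _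

theorem zero_mem_dualBall : (0 : L2) ∈ dualBall := fun w g _ => by
  rw [inner_zero_left]; exact l1Norm_nonneg g

theorem isClosed_dualBall : IsClosed dualBall := by
  simp only [dualBall, Set.ofPred_forall]
  exact isClosed_iInter fun w => isClosed_iInter fun g => isClosed_iInter fun _ =>
    isClosed_le (by fun_prop) continuous_const

theorem convex_dualBall : Convex ℝ dualBall := by
  intro f hf f' hf' a b ha hb hab w g h
  rw [inner_add_left, real_inner_smul_left, real_inner_smul_left]
  calc a * inner ℝ f w + b * inner ℝ f' w ≤ a * l1Norm g + b * l1Norm g := by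
        gcongr
        · exact hf w g h
        · exact hf' w g h
    _ = l1Norm g := by rw [← add_mul, hab, one_mul]

/-- The Fourier multiplier `cos (π kᵢ h)`: the average of the shifts by `±h` in direction `i` of
the even periodic extension. -/
noncomputable def shiftAverage (i : Fin 2) (h : ℝ) (f : L2) : L2 :=
  cosBasis.repr.symm ⟨fun k => Real.cos (Real.pi * k i * h) * cosBasis.repr f k, by
    refine Memℓp.mono' (lp.memℓp (cosBasis.repr f)) fun k => ?_
    rw [norm_mul, Real.norm_eq_abs (Real.cos _)]
    exact mul_le_of_le_one_left (norm_nonneg _) (Real.abs_cos_le_one _)⟩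

theorem inner_shiftAverage (i : Fin 2) (h : ℝ) (f : L2) (k : Fin 2 → ℕ) :
    inner ℝ (cosBasis k) (shiftAverage i h f)
      = Real.cos (Real.pi * k i * h) * inner ℝ (cosBasis k) f := by
  rw [← cosBasis.repr_apply_apply, ← cosBasis.repr_apply_apply, shiftAverage,
    LinearIsometryEquiv.apply_symm_apply]

theorem l1Norm_sum_basisGrad_le (F : Finset (Fin 2 → ℕ)) (c : (Fin 2 → ℕ) → ℝ) (i : Fin 2)
    (h : ℝ) :
    l1Norm (∑ k ∈ F, (Real.cos (Real.pi * k i * h) * c k) • basisGrad k)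
      ≤ l1Norm (∑ k ∈ F, c k • basisGrad k) := by
  simpa only [basisGrad, smul_smul, mul_assoc] using
    l1Norm_sum_cos_mul_le F (fun k => c k * ‖cosLp k‖⁻¹) i h

/-- The multiplier is real, so it can be moved from `f` to the partial Fourier sums of `w`. These
are controlled by the contraction of the L¹ norm, and the L² convergence of their gradients allows
passage to the limit. -/
theorem shiftAverage_mem_dualBall {f : L2} (hf : f ∈ dualBall) (i : Fin 2) (h : ℝ) :
    shiftAverage i h f ∈ dualBall := by
  intro w g hw
  have h1 := cosBasis.hasSum_inner_mul_inner (shiftAverage i h f) w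
  have h2 := (continuous_l1Norm.tendsto g).comp hw.hasSum
  refine le_of_tendsto_of_tendsto' h1 h2 fun F => ?_
  refine le_trans ?_ (l1Norm_sum_basisGrad_le F _ i h)
  refine le_of_eq_of_le ?_ (hf _ _ (mem_gradGraph.1 (sum_mem_gradGraph F _)))
  rw [inner_sum]
  refine Finset.sum_congr rfl fun k _ => ?_
  change inner ℝ (shiftAverage i h f) (cosBasis k) * inner ℝ (cosBasis k) w = _
  rw [real_inner_smul_right, real_inner_comm, inner_shiftAverage, real_inner_comm f]
  ring

/-! ### H¹ regularity of the projection. -/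

theorem summable_inner_sq (u : L2) : Summable fun k => (inner ℝ (cosBasis k) u : ℝ) ^ 2 := by
  refine (cosBasis.summable_inner_mul_inner u u).congr fun k => ?_
  rw [real_inner_comm, sq]

/-- `H¹` regularity of the total variation proximal map: if `u = I - f / α` where `f` is the
projection of `α I` on `dualBall` and `I ∈ H¹(Ω)`, then `u ∈ H¹(Ω)`. -/
theorem memH1_of_projection {α : ℝ} (hα : 0 < α) {u I f : L2} (hI : MemH1 I)
    (hfu : f = α • (I - u)) (hf : f ∈ dualBall)
    (hproj : ∀ k ∈ dualBall, inner ℝ u (k - f) ≤ 0) : MemH1 u := by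
  obtain ⟨gI, hgI⟩ := hI
  set U : (Fin 2 → ℕ) → ℝ := fun k => inner ℝ (cosBasis k) u with hU
  set J : (Fin 2 → ℕ) → ℝ := fun k => inner ℝ (cosBasis k) I with hJ
  have hJs (i : Fin 2) : Summable fun k => (Real.pi * k i) ^ 2 * J k ^ 2 := by
    refine Summable.of_nonneg_of_le (fun k => by positivity) (fun k => ?_) hgI.summable
    refine mul_le_mul_of_nonneg_right ?_ (sq_nonneg _)
    exact Finset.single_le_sum (f := fun i => (Real.pi * (k i : ℝ)) ^ 2)
      (fun _ _ => sq_nonneg _) (Finset.mem_univ i)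
  have compare (i : Fin 2) (h : ℝ) :
      (Summable fun k => (1 - Real.cos (Real.pi * k i * h)) * U k ^ 2) ∧
      (∑' k, (1 - Real.cos (Real.pi * k i * h)) * U k ^ 2)
        ≤ h ^ 2 / 2 * ∑' k, (Real.pi * k i) ^ 2 * J k ^ 2 := by
    have hm0 (k : Fin 2 → ℕ) : 0 ≤ 1 - Real.cos (Real.pi * k i * h) :=
      sub_nonneg.2 (Real.cos_le_one _)
    have hm2 (k : Fin 2 → ℕ) : 1 - Real.cos (Real.pi * k i * h) ≤ 2 := by
      linarith [Real.neg_one_le_cos (Real.pi * k i * h)]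
    have hs (v : L2) : Summable fun k =>
        (1 - Real.cos (Real.pi * k i * h)) * (inner ℝ (cosBasis k) v : ℝ) ^ 2 :=
      Summable.of_nonneg_of_le (fun k => mul_nonneg (hm0 k) (sq_nonneg _))
        (fun k => mul_le_mul_of_nonneg_right (hm2 k) (sq_nonneg _))
        ((summable_inner_sq v).mul_left 2)
    have hUs := hs u
    have hIs := hs I
    refine ⟨hUs, ?_⟩
    -- The coefficients of this pairing are α (1 - cos)(U² - U J). By U J ≤ (U² + J²)/2 they are at
    -- least α/2 (1 - cos)(U² - J²), so the sign of the variational inequality compares `u` with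
    -- `I`.
    have h1 := cosBasis.hasSum_inner_mul_inner u (shiftAverage i h f - f)
    have h2 : HasSum (fun k => α / 2 * ((1 - Real.cos (Real.pi * k i * h)) * U k ^ 2
        - (1 - Real.cos (Real.pi * k i * h)) * J k ^ 2)) _ :=
      (hUs.hasSum.sub hIs.hasSum).mul_left (α / 2)
    have h3 := hasSum_le (fun k => ?_) h2 h1
    · have h4 := h3.trans (hproj _ (shiftAverage_mem_dualBall hf i h))
      have h5 : (∑' k, (1 - Real.cos (Real.pi * k i * h)) * U k ^ 2)
          ≤ ∑' k, (1 - Real.cos (Real.pi * k i * h)) * J k ^ 2 := by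
        by_contra! hn
        have := mul_pos (half_pos hα) (sub_pos.2 hn)
        linarith
      refine h5.trans ?_
      rw [← tsum_mul_left]
      refine hIs.tsum_le_tsum (fun k => ?_) ((hJs i).mul_left _)
      have h6 := Real.one_sub_sq_div_two_le_cos (x := Real.pi * k i * h)
      calc (1 - Real.cos (Real.pi * k i * h)) * J k ^ 2
          ≤ ((Real.pi * k i * h) ^ 2 / 2) * J k ^ 2 :=
            mul_le_mul_of_nonneg_right (by linarith) (sq_nonneg _)
        _ = h ^ 2 / 2 * ((Real.pi * k i) ^ 2 * J k ^ 2) := by ring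
    · have e1 : inner ℝ (cosBasis k) f = α * (J k - U k) := by
        rw [hfu, real_inner_smul_right, inner_sub_right]
      have e2 : inner ℝ u (cosBasis k) = U k := real_inner_comm _ _
      rw [inner_sub_right, inner_shiftAverage, e1, e2]
      have := mul_nonneg (mul_nonneg hα.le (hm0 k)) (sq_nonneg (J k - U k))
      nlinarith
  have hdir (i : Fin 2) : Summable fun k => (Real.pi * k i) ^ 2 * U k ^ 2 := by
    -- The constant is the quotient of 1/2, from 1 - cos x ≤ x²/2, by 2/π², from 1 - cos x ≥ 2x²/π²
    -- on |x| ≤ π.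
    refine summable_of_sum_le
      (c := Real.pi ^ 2 / 4 * ∑' k : Fin 2 → ℕ, (Real.pi * k i) ^ 2 * J k ^ 2)
      (fun k => by positivity) fun F => ?_
    -- `S` dominates every kᵢ in the finite set, so the step h = 1/(S + 1) keeps π kᵢ h within [0,
    -- π], where the quadratic lower bound holds. The factor h² then cancels.
    set S : ℕ := ∑ k ∈ F, k i with hS
    have hS0 : (0 : ℝ) < S + 1 := by positivity
    set h : ℝ := 1 / (S + 1) with hh
    have hh0 : 0 < h := by positivity
    obtain ⟨hUs, hle⟩ := compare i h
    have h1 := (hUs.sum_le_tsum F fun k _ =>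
      mul_nonneg (sub_nonneg.2 (Real.cos_le_one _)) (sq_nonneg _)).trans hle
    have h2 : ∑ k ∈ F, 2 / Real.pi ^ 2 * h ^ 2 * ((Real.pi * k i) ^ 2 * U k ^ 2)
        ≤ ∑ k ∈ F, (1 - Real.cos (Real.pi * k i * h)) * U k ^ 2 := by
      refine Finset.sum_le_sum fun k hk => ?_
      have hk1 : (k i : ℝ) ≤ S + 1 := by
        have := Finset.single_le_sum (f := fun k : Fin 2 → ℕ => k i)
          (fun _ _ => Nat.zero_le _) hk
        have : k i ≤ S + 1 := this.trans (Nat.le_succ _)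
        exact_mod_cast this
      have hk2 : |Real.pi * k i * h| ≤ Real.pi := by
        rw [abs_of_nonneg (by positivity), mul_assoc]
        refine mul_le_of_le_one_right Real.pi_pos.le ?_
        rw [hh, mul_one_div]
        exact (div_le_one hS0).2 hk1
      have h3 := Real.cos_le_one_sub_mul_cos_sq hk2
      calc 2 / Real.pi ^ 2 * h ^ 2 * ((Real.pi * k i) ^ 2 * U k ^ 2)
          = (2 / Real.pi ^ 2 * (Real.pi * k i * h) ^ 2) * U k ^ 2 := by ring
        _ ≤ _ := mul_le_mul_of_nonneg_right (by linarith) (sq_nonneg _)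
    rw [← Finset.mul_sum] at h2
    have h3 := h2.trans h1
    have hc : 0 < 2 / Real.pi ^ 2 * h ^ 2 := by positivity
    refine le_of_mul_le_mul_left (h3.trans_eq ?_) hc
    have := Real.pi_ne_zero
    field_simp
    ring
  obtain ⟨g, hg, -⟩ := exists_isWeakGradient_of_summable (u := u) (by
    simp only [eigenvalue, Finset.sum_mul]
    exact summable_sum fun i _ => hdir i)
  exact ⟨g, hg⟩

/-! ### Total variation as a supremum over the dual ball. -/

/-- The divergence of a test field belongs, up to sign, to `dualBall`, and pairs with `H¹(Ω)` by
integration by parts. -/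
theorem exists_mem_dualBall_of_isTest {φ : Fin 2 → Plane → ℝ} (hφ : ∀ i, IsTest (φ i))
    (hle : ∀ x, ∑ i, φ i x ^ 2 ≤ 1) :
    ∃ k ∈ dualBall, ∀ u g, IsWeakGradient u g →
      inner ℝ k u = ∑ i, ∫ x in Ω, g x i * φ i x := by
  let k : L2 := -∑ i, scalarLp _ (continuous_partial (hφ i).1 (EuclideanSpace.single i 1))
  have hk : ∀ u g, IsWeakGradient u g → inner ℝ k u = ∑ i, ∫ x in Ω, g x i * φ i x := by
    intro u g h
    rw [inner_neg_left, sum_inner, ← Finset.sum_neg_distrib]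
    refine Finset.sum_congr rfl fun i _ => ?_
    rw [inner_scalarLp, h _ (hφ i).1 (hφ i).2.1 (hφ i).2.2 i, neg_neg]
  refine ⟨k, fun w g h => ?_, hk⟩
  have hi (i : Fin 2) : Integrable (fun x => g x i * φ i x) volΩ := by
    obtain ⟨C, hC⟩ := (hφ i).2.1.exists_bound_of_continuous (hφ i).1.continuous
    exact (integrable_coord g i).mul_bdd (c := C) (hφ i).1.continuous.aestronglyMeasurable
      (Filter.Eventually.of_forall hC)
  rw [hk w g h, ← integral_finsetSum _ fun i _ => hi i]
  refine integral_mono (integrable_finsetSum _ fun i _ => hi i) (integrable_norm g) fun x => ?_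
  have h1 : ∑ i, g x i * φ i x = inner ℝ (WithLp.toLp 2 fun i => φ i x) (g x) := by
    simp [PiLp.inner_apply]
  have h2 : ‖(WithLp.toLp 2 fun i => φ i x : Plane)‖ ≤ 1 := by
    rw [← sq_le_one_iff₀ (norm_nonneg _), EuclideanSpace.real_norm_sq_eq]
    exact hle x
  change ∑ i, g x i * φ i x ≤ ‖g x‖
  rw [h1]
  exact (real_inner_le_norm _ _).trans (mul_le_of_le_one_left (norm_nonneg _) h2)

/-- A bound on the pairing of `u` with `dualBall` bounds the pairing of its gradient with smooth
fields of norm at most `1`. -/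
theorem inner_vecLp_le_of_dualBall {u : L2} {g : L2Vec} (hg : IsWeakGradient u g) {c : ℝ}
    (hc : ∀ k ∈ dualBall, inner ℝ k u ≤ c) {q : Plane → Plane} (hq : ContDiff ℝ ∞ q)
    (hq1 : ∀ x, ‖q x‖ ≤ 1) : inner ℝ (vecLp q hq.continuous) g ≤ c := by
  have hqi (i : Fin 2) : ContDiff ℝ ∞ fun x => q x i := contDiff_euclidean.1 hq i
  have hi (i : Fin 2) : Integrable (fun x => g x i * q x i) volΩ :=
    (integrable_coord g i).mul_bdd (c := 1) (hqi i).continuous.aestronglyMeasurable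
      (Filter.Eventually.of_forall fun x => (PiLp.norm_apply_le (q x) i).trans (hq1 x))
  have e : inner ℝ (vecLp q hq.continuous) g = ∑ i, ∫ x in Ω, g x i * q x i := by
    rw [inner_vecLp, ← integral_finsetSum _ fun i _ => hi i]
    refine integral_congr_ae (Filter.Eventually.of_forall fun x => ?_)
    simp [PiLp.inner_apply]
  rw [e]
  -- The field is cut off near the boundary to become an admissible test field; the norm bound
  -- survives and the pairings converge.
  refine le_of_tendsto' (tendsto_finsetSum Finset.univ fun i _ =>
    tendsto_setIntegral_cutoffΩ_mul g i (hqi i).continuous) fun n => ?_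
  have hle (x : Plane) : ∑ i, (cutoffΩ n x * q x i) ^ 2 ≤ 1 := by
    have h1 : ∑ i, q x i ^ 2 ≤ 1 := by
      rw [← EuclideanSpace.real_norm_sq_eq]
      exact pow_le_one₀ (norm_nonneg _) (hq1 x)
    simp only [mul_pow, ← Finset.mul_sum]
    have h2 : cutoffΩ n x ^ 2 ≤ 1 := (sq_le_one_iff_abs_le_one _).2 (abs_cutoffΩ_le_one n x)
    exact mul_le_one₀ h2 (Finset.sum_nonneg fun _ _ => sq_nonneg _) h1
  obtain ⟨k, hk, hk'⟩ := exists_mem_dualBall_of_isTest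
    (fun i => isTest_cutoffΩ_mul n (hqi i)) hle
  rw [← hk' u g hg]
  exact hc k hk

/-- Normalization of a vector, regularized at `0`. -/
noncomputable def softNormalize (δ : ℝ) (v : Plane) : Plane := (√(δ ^ 2 + ‖v‖ ^ 2))⁻¹ • v

theorem contDiff_softNormalize {δ : ℝ} (hδ : 0 < δ) : ContDiff ℝ ∞ (softNormalize δ) := by
  have h (v : Plane) : δ ^ 2 + ‖v‖ ^ 2 ≠ 0 := by positivity
  unfold softNormalize
  exact (((contDiff_const.add (contDiff_norm_sq ℝ)).sqrt h).inv
    fun v => (Real.sqrt_pos.2 (by positivity)).ne').smul contDiff_id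

theorem norm_softNormalize_le {δ : ℝ} (hδ : 0 < δ) (v : Plane) : ‖softNormalize δ v‖ ≤ 1 := by
  have h0 : 0 < √(δ ^ 2 + ‖v‖ ^ 2) := Real.sqrt_pos.2 (by positivity)
  rw [softNormalize, norm_smul, norm_inv, Real.norm_eq_abs, abs_of_pos h0, ← div_eq_inv_mul,
    div_le_one h0]
  exact Real.le_sqrt_of_sq_le (by nlinarith)

theorem norm_sub_le_inner_softNormalize {δ : ℝ} (hδ : 0 < δ) (v : Plane) :
    ‖v‖ - δ ≤ inner ℝ (softNormalize δ v) v := by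
  have h0 : 0 < √(δ ^ 2 + ‖v‖ ^ 2) := Real.sqrt_pos.2 (by positivity)
  have h1 : √(δ ^ 2 + ‖v‖ ^ 2) ≤ δ + ‖v‖ :=
    Real.sqrt_le_iff.2 ⟨by positivity, by nlinarith [norm_nonneg v]⟩
  have h2 : δ ≤ √(δ ^ 2 + ‖v‖ ^ 2) := Real.le_sqrt_of_sq_le (by nlinarith [norm_nonneg v])
  rw [softNormalize, real_inner_smul_left, real_inner_self_eq_norm_sq, ← div_eq_inv_mul,
    le_div_iff₀ h0]
  nlinarith [norm_nonneg v]

/-- Allows the normalized field to be built from a smooth approximation `w` of `v`: the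
regularization costs δ, and replacing `v` by `w` costs ‖v - w‖ twice. -/
theorem norm_le_inner_softNormalize {δ : ℝ} (hδ : 0 < δ) (v w : Plane) :
    ‖v‖ ≤ inner ℝ (softNormalize δ w) v + δ + 2 * ‖v - w‖ := by
  have h1 := norm_sub_le_inner_softNormalize hδ w
  have h2 : inner ℝ (softNormalize δ w) (w - v) ≤ ‖v - w‖ := by
    rw [norm_sub_rev]
    exact (real_inner_le_norm _ _).trans
      (mul_le_of_le_one_left (norm_nonneg _) (norm_softNormalize_le hδ w))
  rw [inner_sub_right] at h2
  have h3 : ‖v‖ ≤ ‖w‖ + ‖v - w‖ := by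
    have := norm_add_le w (v - w)
    rwa [add_sub_cancel] at this
  linarith

/-- Dual characterization of the total variation on `H¹(Ω)`. -/
theorem l1Norm_le_of_dualBall {u : L2} {g : L2Vec} (hg : IsWeakGradient u g) {c : ℝ}
    (hc : ∀ k ∈ dualBall, inner ℝ k u ≤ c) : l1Norm g ≤ c := by
  obtain ⟨C, hC0, hC⟩ := exists_l1Norm_le
  -- The test field normalizes a smooth `H` within δ of `g` in L². The two errors are δ integrated
  -- over the square and twice the L¹ distance, at most C δ.
  have main : ∀ δ > 0, l1Norm g ≤ c + δ * volΩ.real univ + 2 * (C * δ) := by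
    intro δ hδ
    obtain ⟨h, ⟨H, hH, -, hHs⟩, hd⟩ := Metric.mem_closure_iff.1
      (MeasureTheory.Lp.dense_hasCompactSupport_contDiff (F := Plane) (μ := volΩ) (p := 2)
        (by norm_num) g) δ hδ
    have hq : ContDiff ℝ ∞ fun x => softNormalize δ (H x) := (contDiff_softNormalize hδ).comp hHs
    have h1 := inner_vecLp_le_of_dualBall hg hc hq fun x => norm_softNormalize_le hδ _
    have hint : Integrable (fun x => inner ℝ (softNormalize δ (H x)) (g x)) volΩ := by
      refine (L2.integrable_inner (𝕜 := ℝ) (vecLp _ hq.continuous) g).congr ?_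
      filter_upwards [coeFn_vecLp hq.continuous] with x hx
      rw [hx]
    have hint' : Integrable (fun x => inner ℝ (softNormalize δ (H x)) (g x) + δ) volΩ :=
      hint.add (integrable_const δ)
    have h2 : l1Norm g ≤ ∫ x in Ω, (inner ℝ (softNormalize δ (H x)) (g x) + δ
        + 2 * ‖(g - h) x‖) := by
      refine integral_mono_ae (integrable_norm g)
        (hint'.add ((integrable_norm (g - h)).const_mul 2)) ?_
      filter_upwards [hH, Lp.coeFn_sub g h] with x e1 e2
      rw [e2, Pi.sub_apply, e1]
      exact norm_le_inner_softNormalize hδ _ _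
    rw [integral_add hint' ((integrable_norm (g - h)).const_mul 2),
      integral_add hint (integrable_const δ), ← inner_vecLp hq.continuous, integral_const,
      integral_const_mul] at h2
    have h3 : l1Norm (g - h) ≤ C * δ :=
      (hC _).trans (mul_le_mul_of_nonneg_left (by rw [← dist_eq_norm]; exact hd.le) hC0)
    rw [l1Norm] at h3
    rw [smul_eq_mul] at h2
    linarith
  have hlim : Filter.Tendsto (fun δ : ℝ => c + δ * volΩ.real univ + 2 * (C * δ))
      (nhdsWithin 0 (Ioi 0)) (nhds c) := by
    have : Continuous fun δ : ℝ => c + δ * volΩ.real univ + 2 * (C * δ) := by fun_prop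
    have h := this.tendsto 0
    simp only [zero_mul, mul_zero, add_zero] at h
    exact h.mono_left nhdsWithin_le_nhds
  exact ge_of_tendsto hlim (eventually_mem_nhdsWithin.mono main)

/-! ### Dual fields by Hahn–Banach. -/

/-- Elements of `dualBall` are represented by a field `ν` of `L∞` norm at most `1`, expressed as
`∫ ν · v ≤ ∫ |v|` for all `v`. -/
theorem exists_field_of_mem_dualBall {f : L2} (hf : f ∈ dualBall) :
    ∃ ν : L2Vec, (∀ v, inner ℝ ν v ≤ l1Norm v) ∧
      ∀ w g, IsWeakGradient w g → inner ℝ ν g = inner ℝ f w := by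
  -- Extending from the graph in L² × L² avoids having to define a functional of ∇w alone, so
  -- functions with the same gradient need no separate treatment.
  let ℓ : L2 × L2Vec →ₗ.[ℝ] ℝ :=
    ⟨gradGraph, ((innerSL ℝ f : L2 →ₗ[ℝ] ℝ).comp (LinearMap.fst ℝ L2 L2Vec)).domRestrict
      gradGraph⟩
  obtain ⟨G, hG1, hG2⟩ := exists_extension_of_le_sublinear ℓ (fun p => l1Norm p.2)
    (fun c hc p => by rw [Prod.smul_snd, l1Norm_smul, abs_of_pos hc])
    (fun p q => l1Norm_add_le p.2 q.2)
    (fun p => hf p.1.1 p.1.2 (mem_gradGraph.1 p.2))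
  -- The sublinear majorant ignores the first component, so the extension is at most 0 at both (w,
  -- 0) and its negative.
  have hG0 (w : L2) : G (w, 0) = 0 := by
    have h0 : l1Norm 0 = 0 := by simpa using l1Norm_smul 0 0
    have h1 : G (w, 0) ≤ 0 := (hG2 (w, 0)).trans_eq h0
    have h2 : G (-(w, 0)) ≤ 0 := (hG2 (-(w, 0))).trans_eq (by simpa using h0)
    rw [map_neg] at h2
    linarith
  obtain ⟨C, hC0, hC⟩ := exists_l1Norm_le
  let P : L2Vec →ₗ[ℝ] ℝ := G.comp (LinearMap.inr ℝ L2 L2Vec)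
  have hP (v : L2Vec) : P v ≤ l1Norm v := hG2 (0, v)
  let T : L2Vec →L[ℝ] ℝ := P.mkContinuous C fun v => by
    refine abs_le.2 ⟨?_, (hP v).trans (hC v)⟩
    have := (hP (-v)).trans (hC (-v))
    rw [map_neg, norm_neg] at this
    linarith
  have hT (v : L2Vec) : inner ℝ ((InnerProductSpace.toDual ℝ L2Vec).symm T) v = G (0, v) := by
    rw [InnerProductSpace.toDual_symm_apply]; rfl
  refine ⟨(InnerProductSpace.toDual ℝ L2Vec).symm T, fun v => ?_, fun w g h => ?_⟩
  · rw [hT]; exact hG2 (0, v)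
  · have h1 := hG1 ⟨(w, g), mem_gradGraph.2 h⟩
    have h2 : ((w, g) : L2 × L2Vec) = (w, 0) + (0, g) := by simp
    rw [hT]
    change G (w, g) = inner ℝ f w at h1
    rw [← h1, h2, map_add, hG0, zero_add]

/-! ### The optimality system and the saddle point. -/

theorem augLagrangian_eq (α ρ : ℝ) (I : L2) (p : H1 × L2Vec) (μ : L2Vec) :
    augLagrangian α ρ I p μ = l1Norm p.2 + inner ℝ μ (p.2 - p.1.grad)
      + ρ / 2 * ‖p.2 - p.1.grad‖ ^ 2 + α / 2 * ‖p.1.1 - I‖ ^ 2 := by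
  rw [← real_inner_self_eq_norm_sq (p.2 - p.1.grad), ← real_inner_self_eq_norm_sq (p.1.1 - I),
    L2.inner_def, L2.inner_def, L2.inner_def, l1Norm, ← integral_const_mul, ← integral_const_mul,
    ← integral_add, ← integral_add, ← integral_add]
  · refine integral_congr_ae ?_
    filter_upwards [Lp.coeFn_sub p.2 p.1.grad, Lp.coeFn_sub p.1.1 I] with x h1 h2
    rw [h1, h2, integrand, Pi.sub_apply, Pi.sub_apply, real_inner_self_eq_norm_sq,
      real_inner_self_eq_norm_sq, Real.norm_eq_abs, sq_abs]
  · exact ((integrable_norm _).add (L2.integrable_inner _ _)).add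
      ((L2.integrable_inner _ _).const_mul _)
  · exact (L2.integrable_inner _ _).const_mul _
  · exact (integrable_norm _).add (L2.integrable_inner _ _)
  · exact (L2.integrable_inner _ _).const_mul _
  · exact integrable_norm _
  · exact L2.integrable_inner _ _

/-- The optimality system of the total variation denoising problem has a solution in `H¹(Ω)`: a
minimizer `u` together with a dual field `ν`. -/
theorem exists_optimality_system {α : ℝ} (hα : 0 < α) {I : L2} (hI : MemH1 I) :
    ∃ (u : H1) (ν : L2Vec), (∀ v, inner ℝ ν v ≤ l1Norm v) ∧ inner ℝ ν u.grad = l1Norm u.grad ∧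
      ∀ w : H1, inner ℝ ν w.grad = α * inner ℝ (I - u.1) w.1 := by
  obtain ⟨f, hf, hmin⟩ := exists_norm_eq_iInf_of_complete_convex ⟨0, zero_mem_dualBall⟩
    isClosed_dualBall.isComplete convex_dualBall (α • I)
  have hvar := (norm_eq_iInf_iff_real_inner_le_zero convex_dualBall hf).1 hmin
  set u : L2 := α⁻¹ • (α • I - f) with hu
  have hαu : α • u = α • I - f := by rw [hu, smul_smul, mul_inv_cancel₀ hα.ne', one_smul]
  have hfu : f = α • (I - u) := by rw [smul_sub, hαu, sub_sub_cancel]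
  have hproj (k : L2) (hk : k ∈ dualBall) : inner ℝ u (k - f) ≤ 0 := by
    rw [hu, real_inner_smul_left]
    exact mul_nonpos_of_nonneg_of_nonpos (inv_nonneg.2 hα.le) (hvar k hk)
  have hu1 : MemH1 u := memH1_of_projection hα hI hfu hf hproj
  obtain ⟨ν, hν1, hν2⟩ := exists_field_of_mem_dualBall hf
  let U : H1 := ⟨u, hu1⟩
  refine ⟨U, ν, hν1, le_antisymm (hν1 _) ?_, fun w => ?_⟩
  · rw [hν2 _ _ U.grad_spec]
    -- The variational inequality says exactly that `f` maximizes the pairing with `u` over the dual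
    -- ball.
    refine l1Norm_le_of_dualBall U.grad_spec fun k hk => ?_
    have := hproj k hk
    rw [inner_sub_right, real_inner_comm, real_inner_comm f u] at this
    exact sub_nonpos.1 this
  · rw [hν2 _ _ w.grad_spec, hfu, real_inner_smul_left]

/-- At v = ∇u the value does not depend on the multiplier. At -ν, the optimality system cancels the
linear term of the fidelity expanded around `u`; what remains above the saddle value is ∫ |v| - ∫
ν·v and two squares, all nonnegative. -/
theorem exists_isSaddlePointOn {α ρ : ℝ} (hα : 0 < α) (hρ : 0 < ρ) {I : L2} (hI : MemH1 I) :
    ∃ (p : H1 × L2Vec) (μ : L2Vec), IsSaddlePointOn univ univ (augLagrangian α ρ I) p μ := by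
  obtain ⟨u, ν, h1, h2, h3⟩ := exists_optimality_system hα hI
  refine ⟨(u, u.grad), -ν, fun q _ μ _ => ?_⟩
  rw [augLagrangian_eq, augLagrangian_eq]
  simp only [sub_self, inner_zero_right, norm_zero, inner_neg_left, inner_sub_right]
  have e1 := h1 q.2
  have e2 : inner ℝ ν q.1.grad - l1Norm u.grad = α * inner ℝ (I - u.1) (q.1.1 - u.1) := by
    rw [← h2, h3, h3, inner_sub_right]; ring
  have e3 : ‖q.1.1 - I‖ ^ 2 = ‖q.1.1 - u.1‖ ^ 2 - 2 * inner ℝ (I - u.1) (q.1.1 - u.1)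
      + ‖u.1 - I‖ ^ 2 := by
    have : q.1.1 - I = (q.1.1 - u.1) - (I - u.1) := by abel
    rw [this, norm_sub_sq_real, real_inner_comm, norm_sub_rev u.1 I]
  have e4 : 0 ≤ ρ / 2 * ‖q.2 - q.1.grad‖ ^ 2 := by positivity
  have e5 : 0 ≤ α / 2 * ‖q.1.1 - u.1‖ ^ 2 := by positivity
  rw [e3]
  linarith

end TVSaddle

theorem theorem2 (α ρ : ℝ) (hα : 0 < α) (hρ : 0 < ρ)
    (I : TVSaddle.L2) (hI : TVSaddle.MemH1 I) :
    ∃ (p : TVSaddle.H1 × TVSaddle.L2Vec) (μ : TVSaddle.L2Vec),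
      IsSaddlePointOn univ univ (TVSaddle.augLagrangian α ρ I) p μ ∧
      IsLeast (range fun q => ⨆ ν, (TVSaddle.augLagrangian α ρ I q ν : EReal))
        (TVSaddle.augLagrangian α ρ I p μ : EReal) ∧
      IsGreatest (range fun ν => ⨅ q, (TVSaddle.augLagrangian α ρ I q ν : EReal))
        (TVSaddle.augLagrangian α ρ I p μ : EReal) ∧
      (⨅ q, ⨆ ν, (TVSaddle.augLagrangian α ρ I q ν : EReal))
        = (⨆ ν, ⨅ q, (TVSaddle.augLagrangian α ρ I q ν : EReal)) := by
  obtain ⟨p, μ, h⟩ := TVSaddle.exists_isSaddlePointOn hα hρ hI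
  -- This single inequality contains both saddle inequalities, by taking ν = μ or q = p. Extended
  -- reals are needed since the inner supremum can be infinite.
  have hle (q ν) : (TVSaddle.augLagrangian α ρ I p ν : EReal) ≤ TVSaddle.augLagrangian α ρ I q μ :=
    EReal.coe_le_coe_iff.2 (h q (mem_univ q) ν (mem_univ ν))
  have hleast : IsLeast (range fun q => ⨆ ν, (TVSaddle.augLagrangian α ρ I q ν : EReal))
      (TVSaddle.augLagrangian α ρ I p μ : EReal) := by
    refine ⟨⟨p, le_antisymm (iSup_le fun ν => hle p ν)
      (le_iSup (fun ν => (TVSaddle.augLagrangian α ρ I p ν : EReal)) μ)⟩, ?_⟩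
    rintro _ ⟨q, rfl⟩
    exact (hle q μ).trans (le_iSup (fun ν => (TVSaddle.augLagrangian α ρ I q ν : EReal)) μ)
  have hgreatest : IsGreatest (range fun ν => ⨅ q, (TVSaddle.augLagrangian α ρ I q ν : EReal))
      (TVSaddle.augLagrangian α ρ I p μ : EReal) := by
    refine ⟨⟨μ, le_antisymm (iInf_le (fun q => (TVSaddle.augLagrangian α ρ I q μ : EReal)) p)
      (le_iInf fun q => hle q μ)⟩, ?_⟩
    rintro _ ⟨ν, rfl⟩
    exact (iInf_le (fun q => (TVSaddle.augLagrangian α ρ I q ν : EReal)) p).trans (hle p ν)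
  exact ⟨p, μ, h, hleast, hgreatest, hleast.isGLB.sInf_eq.trans hgreatest.isLUB.sSup_eq.symm⟩
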